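/- For $\beta\in\{1,4\}$ and an integer $N\ge 0$ let $\lambda_1,\dots,\lambda_N$ be the eigenvalues of the Gaussian orthogonal ($\beta=1$) or symplectic ($\beta=4$) ensemble, i.e. real random variables with joint density $$\frac1{Z_{\beta,N}}\prod_{j=1}^N e^{-\beta\lambda_j^2/2}\prod_{j<k}|\lambda_k-\lambda_j|^\beta ,$$ where $Z_{\beta,N}$ is the integral of the numerator over $\mathbb R^N$, and let $F_{\beta,N}(y)=\Pr(\lambda_j<y\text{ for all }j)$ be the distribution function of the largest eigenvalue. For $y\in\mathbb R\cup\{\infty\}$ and polynomials $f,g$ put $$(f,g)_2^y=\int_{-\infty}^y e^{-x^2}fg\,dx,\qquad \langle f,g\rangle_4^y=\tfrac12\int_{-\infty}^y e^{-2x^2}(fg'-gf')\,dx,\qquad \langle\!\langle f,g\rangle\!\rangle_4^y=\tfrac12\int_{-\infty}^y e^{-x^2}(fg'-gf')\,dx,$$ $$\langle f,g\rangle_1^y=\tfrac12\int_{-\infty}^y e^{-x^2/2}f(x)\int_{-\infty}^y e^{-z^2/2}g(z)\,\mathrm{sgn}(z-x)\,dz\,dx .$$ A family of monic real polynomials $(\eta_j)_{j\ge0}$,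 $\deg\eta_j=j$, is called skew-orthogonal for a skew form $\langle\cdot,\cdot\rangle$, with normalizations $c_j$, if $\langle\eta_{2j},\eta_{2k}\rangle=\langle\eta_{2j+1},\eta_{2k+1}\rangle=0$ and $\langle\eta_{2j},\eta_{2k+1}\rangle=-\langle\eta_{2k+1},\eta_{2j}\rangle=c_j\delta_{jk}$ for all $j,k\ge 0$. The Pfaffian of a $2n\times2n$ skew-symmetric matrix $M$ is $\mathrm{Pf}\,M=\frac1{2^nn!}\sum_{P\in S_{2n}}\varepsilon(P)\prod_{i=1}^nM_{P(2i-1),P(2i)}$ (equal to $1$ for $n=0$). For every $y\in\mathbb R$ there is exactly one family of monic polynomials $p_j=p_j(\cdot,y)$, $\deg p_j=j$ (the Nadal--Majumdar polynomials), with $(p_j,p_k)_2^y=0$ for $j\ne k$; let $h_j=h_j(y)=(p_j,p_j)_2^y$. Skew-orthogonal families exist for $\langle\cdot,\cdot\rangle_1^y$ and $\langle\!\langle\cdot,\cdot\rangle\!\rangle_4^y$ with any $y\in\mathbb R$, and for $\langle\cdot,\cdot\rangle_1^\infty$ and $\langle\cdot,\cdot\rangle_4^\infty$. For any such families, let their normalizations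 be $r_j(y)$, $\tilde q_j(y)$, $r_j(\infty)$, $q_j(\infty)$ respectively. Let $\mathbf W_m=\mathbf W_m(y)$ and $\mathbf V_m=\mathbf V_m(y)$ be the skew-symmetric matrices with rows and columns indexed by $0,\dots,m$ (empty for $m=-1$) and with entries, for $j<k$, $$w_{j,k}=\delta_{j+1,k}h_k+\tfrac12e^{-y^2}p_j(y,y)p_k(y,y),\qquad v_{j,j+1}=h_j-X_{j,j+1}-\Phi_{j,j+1},\qquad v_{j,k}=X_{k,j}+\Phi_{k,j}\ (k\ge j+2),$$ where $$\Phi_{j,k}=\tfrac12\int_{-\infty}^ye^{-z^2/2}p_j(z,y)\,dz\int_y^\infty e^{-z^2/2}p_k(z,y)\,dz,$$ $$X_{j,k}=\tfrac12\left(\int_{-\infty}^yp_j(x,y)e^{-x^2/2}\,\mathrm{erf}\Big(\frac x{\sqrt2}\Big)dx\right)\int_{-\infty}^\infty e^{-z^2/2}p_k(z,y)\,dz .$$ Then, for every $y\in\mathbb R$ and every even $N$, $$F_{1,N}(y)=\prod_{j=0}^{N/2-1}\frac{r_j(y)}{r_j(\infty)}=\frac{2^{\frac N2(\frac N2-1)}}{\pi^{N/4}}\prod_{j=0}^{N/2-1}\frac1{(2j)!}\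 \mathrm{Pf}\,\mathbf V_{N-1}(y),$$ and, for every $y\in\mathbb R$ and every $N$, $$F_{4,N}(y)=\prod_{j=0}^{N-1}2^{-2j-\frac12}\,\frac{\tilde q_j(\sqrt2y)}{q_j(\infty)}=\frac{2^{N^2}}{\pi^{N/2}}\prod_{j=0}^{N-1}\frac1{(2j+1)!}\ \mathrm{Pf}\,\mathbf W_{2N-1}(\sqrt2y).$$ -/

import Mathlib

open MeasureTheory Polynomial

noncomputable section

namespace GaussianBeta

/-! ### Eigenvalue distribution of the Gaussian ensembles -/

/-- Unnormalised joint eigenvalue density of the Gaussian `β`-ensemble,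
`∏ⱼ exp (-β λⱼ² / 2) · ∏_{j<k} |λₖ - λⱼ| ^ β`. -/
def eigWeight (β N : ℕ) (l : Fin N → ℝ) : ℝ :=
  (∏ j, Real.exp (-(β : ℝ) * l j ^ 2 / 2)) *
    ∏ j : Fin N, ∏ k ∈ Finset.Ioi j, |l k - l j| ^ β

/-- The normalisation constant `Z_{β,N}`. -/
def partitionZ (β N : ℕ) : ℝ := ∫ l : Fin N → ℝ, eigWeight β N l

/-- The joint law of the eigenvalues `λ₁, …, λ_N`, with density
`eigWeight β N / partitionZ β N` with respect to Lebesgue measure. -/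
def eigLaw (β N : ℕ) : Measure (Fin N → ℝ) :=
  volume.withDensity fun l => ENNReal.ofReal (eigWeight β N l / partitionZ β N)

/-- The distribution function `F_{β,N}(y)` of the largest eigenvalue: the probability that
all eigenvalues are less than `y`. -/
def largestCDF (β N : ℕ) (y : ℝ) : ℝ := (eigLaw β N).real {l | ∀ i, l i < y}

/-! ### Inner product and skew-inner products

The domain of integration `D` is `Set.Iic y` for the products with parameter `y`,
and `Set.univ` for the products with parameter `∞`. -/

/-- `(f, g)₂ = ∫_D exp (-x²) f(x) g(x) dx`. -/
def ip2 (D : Set ℝ) (f g : ℝ[X]) : ℝ :=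
  ∫ x in D, Real.exp (-x ^ 2) * f.eval x * g.eval x

/-- `⟨f, g⟩₄ = ½ ∫_D exp (-2x²) (f g' - g f') dx`. -/
def skew4 (D : Set ℝ) (f g : ℝ[X]) : ℝ :=
  (1 / 2) * ∫ x in D, Real.exp (-2 * x ^ 2) *
    (f.eval x * g.derivative.eval x - g.eval x * f.derivative.eval x)

/-- The modified product `⟪f, g⟫₄ = ½ ∫_D exp (-x²) (f g' - g f') dx`. -/
def skew4Mod (D : Set ℝ) (f g : ℝ[X]) : ℝ :=
  (1 / 2) * ∫ x in D, Real.exp (-x ^ 2) *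
    (f.eval x * g.derivative.eval x - g.eval x * f.derivative.eval x)

/-- `⟨f, g⟩₁ = ½ ∫_D exp (-x²/2) f(x) ∫_D exp (-z²/2) g(z) sgn (z - x) dz dx`. -/
def skew1 (D : Set ℝ) (f g : ℝ[X]) : ℝ :=
  (1 / 2) * ∫ x in D, Real.exp (-x ^ 2 / 2) * f.eval x *
    ∫ z in D, Real.exp (-z ^ 2 / 2) * g.eval z * Real.sign (z - x)

/-- `p 0, p 1, …` are monic polynomials, `p j` of degree `j`. -/
def IsMonicFamily (p : ℕ → ℝ[X]) : Prop := ∀ j, (p j).Monic ∧ (p j).natDegree = j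

/-- The family of monic polynomials orthogonal for the bilinear form `B`. -/
def IsOrthogonalFamily (B : ℝ[X] → ℝ[X] → ℝ) (p : ℕ → ℝ[X]) : Prop :=
  IsMonicFamily p ∧ ∀ j k, j ≠ k → B (p j) (p k) = 0

/-- The normalisation `⟨R_{2j}, R_{2j+1}⟩` of a skew-orthogonal family. -/
def skewNorm (B : ℝ[X] → ℝ[X] → ℝ) (R : ℕ → ℝ[X]) (j : ℕ) : ℝ := B (R (2 * j)) (R (2 * j + 1))

/-- A family of monic polynomials that is skew-orthogonal for the skew form `B`. -/
def IsSkewOrthogonalFamily (B : ℝ[X] → ℝ[X] → ℝ) (R : ℕ → ℝ[X]) : Prop :=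
  IsMonicFamily R ∧ ∀ j k,
    B (R (2 * j)) (R (2 * k)) = 0 ∧
    B (R (2 * j + 1)) (R (2 * k + 1)) = 0 ∧
    B (R (2 * j)) (R (2 * k + 1)) = (if j = k then skewNorm B R j else 0) ∧
    B (R (2 * k + 1)) (R (2 * j)) = -(if j = k then skewNorm B R j else 0)

/-- The Nadal–Majumdar polynomials with parameter `y`: `p j` is `p_j(·, y)`. -/
def IsNadalMajumdar (y : ℝ) (p : ℕ → ℝ[X]) : Prop := IsOrthogonalFamily (ip2 (Set.Iic y)) p

/-! ### Pfaffians and the matrices `V` and `W` -/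

/-- The Pfaffian of a `2n × 2n` matrix,
`1 / (2ⁿ n!) ∑_σ sgn σ ∏_{i<n} M_{σ(2i), σ(2i+1)}` (indices starting from `0`). -/
def pfaffian {n : ℕ} (M : Matrix (Fin (2 * n)) (Fin (2 * n)) ℝ) : ℝ :=
  1 / (2 ^ n * (n.factorial : ℝ)) *
    ∑ σ : Equiv.Perm (Fin (2 * n)), ((Equiv.Perm.sign σ : ℤ) : ℝ) *
      ∏ i : Fin n, M (σ ⟨2 * i, by omega⟩) (σ ⟨2 * i + 1, by omega⟩)

/-- The skew-symmetric `m × m` matrix (rows and columns `0, …, m-1`) with entries `v j k`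
for `j < k`. -/
def skewMatrix (v : ℕ → ℕ → ℝ) (m : ℕ) : Matrix (Fin m) (Fin m) ℝ :=
  Matrix.of fun j k => if j < k then v j k else if k < j then -v k j else 0

/-- `h_j(y) = (p_j, p_j)₂`. -/
def hNorm (y : ℝ) (p : ℕ → ℝ[X]) (j : ℕ) : ℝ := ip2 (Set.Iic y) (p j) (p j)

/-- `Ω_{j,k} = exp (-y²) p_j(y, y) p_k(y, y)`. -/
def omegaEntry (y : ℝ) (p : ℕ → ℝ[X]) (j k : ℕ) : ℝ :=
  Real.exp (-y ^ 2) * (p j).eval y * (p k).eval y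

/-- `w_{j,k} = δ_{j+1,k} h_k + Ω_{j,k} / 2`. -/
def wEntry (y : ℝ) (p : ℕ → ℝ[X]) (j k : ℕ) : ℝ :=
  (if j + 1 = k then hNorm y p k else 0) + omegaEntry y p j k / 2

/-- The `m × m` matrix with rows and columns `0, …, m-1` denoted `W_{m-1}`
(subscript = last index). -/
def wMatrix (y : ℝ) (p : ℕ → ℝ[X]) (m : ℕ) : Matrix (Fin m) (Fin m) ℝ :=
  skewMatrix (wEntry y p) m

/-- The error function `erf x = (2 / √π) ∫₀ˣ exp (-t²) dt`. -/
def erf (x : ℝ) : ℝ := 2 / Real.sqrt Real.pi * ∫ t in (0 : ℝ)..x, Real.exp (-t ^ 2)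

/-- `Φ_{j,k} = ½ ∫_{-∞}^y exp (-z²/2) p_j dz · ∫_y^∞ exp (-z²/2) p_k dz`. -/
def phiEntry (y : ℝ) (p : ℕ → ℝ[X]) (j k : ℕ) : ℝ :=
  (1 / 2) * (∫ z in Set.Iic y, Real.exp (-z ^ 2 / 2) * (p j).eval z) *
    ∫ z in Set.Ioi y, Real.exp (-z ^ 2 / 2) * (p k).eval z

/-- `X_{j,k} = ½ (∫_{-∞}^y p_j exp (-x²/2) erf (x/√2) dx) · ∫_{-∞}^∞ exp (-z²/2) p_k dz`. -/
def xEntry (y : ℝ) (p : ℕ → ℝ[X]) (j k : ℕ) : ℝ :=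
  (1 / 2) *
    (∫ x in Set.Iic y, (p j).eval x * Real.exp (-x ^ 2 / 2) * erf (x / Real.sqrt 2)) *
    ∫ z : ℝ, Real.exp (-z ^ 2 / 2) * (p k).eval z

/-- For `j < k`: `v_{j,j+1} = h_j - X_{j,j+1} - Φ_{j,j+1}`, and
`v_{j,k} = X_{k,j} + Φ_{k,j}` if `k ≥ j + 2`. -/
def vEntry (y : ℝ) (p : ℕ → ℝ[X]) (j k : ℕ) : ℝ :=
  if j + 1 = k then hNorm y p j - xEntry y p j k - phiEntry y p j k
  else xEntry y p k j + phiEntry y p k j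

/-- The `m × m` matrix with rows and columns `0, …, m-1` denoted `V_{m-1}`
(subscript = last index). -/
def vMatrix (y : ℝ) (p : ℕ → ℝ[X]) (m : ℕ) : Matrix (Fin m) (Fin m) ℝ :=
  skewMatrix (vEntry y p) m

end GaussianBeta

end

/-! The distribution function is the integral of the unnormalised density over (-∞, y]^N divided by
its integral over ℝ^N (`largestCDF_eq`). De Bruijn's formulas (`eigIntegral_four`,
`eigIntegral_one`) express each integral as a factor independent of the domain times the Pfaffian of
the Gram matrix of a skew form. The Gram matrix may be taken in any monic family, because the
(confluent) Vandermonde determinant is the same for all of them. All the identities come from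
choosing this family well.

For β = 4 the fourth power of the Vandermonde product is the confluent determinant with columns
P(x_i), P'(x_i). For β = 1 the absolute value is removed by sgn Δ(x) = Pf(sgn(x_b - x_a)), after
which the variables are integrated in pairs. In both cases the Leibniz expansion is integrated term
by term, and the resulting signed sum `pfSum` is a Pfaffian up to a constant.

A skew-orthogonal family turns the Pfaffian into the product of its normalizations. The
Nadal-Majumdar polynomials turn the Gram matrix into W or V: integration by parts splits each skew
product into boundary or error-function terms plus a product (p_j, ·)_2, which orthogonality reduces
to at most one norm. On the whole line the orthogonal polynomials make the block of even rows and
odd columns triangular, so the denominator is a product of explicit norms. For β = 4 the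
substitution u = √2 x replaces the weight e^{-2x²} by e^{-x²} and y by √2 y.

Skew-orthogonal families exist because the density is positive on a nonempty open set. The Gram
Pfaffians of every monic family are then nonzero, and the form is nondegenerate on polynomials of
degree below 2n. -/

noncomputable section

namespace GaussianBeta

/-! ### Signed sums over permutations of pairs -/

section Combinatorics

variable {κ : Type*} [Fintype κ] [DecidableEq κ]

/-- The signed sum over permutations that defines the Pfaffian, for a matrix whose index set is
a set of pairs. -/
def pfSum (M : κ × Fin 2 → κ × Fin 2 → ℝ) : ℝ :=
  ∑ σ : Equiv.Perm (κ × Fin 2), ((Equiv.Perm.sign σ : ℤ) : ℝ) * ∏ i, M (σ (i, 0)) (σ (i, 1))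

/-- The square matrix whose columns with index `(i, 0)` and `(i, 1)` are `U i` and `V i`. -/
def pairMatrix (U V : κ × Fin 2 → κ → ℝ) : Matrix (κ × Fin 2) (κ × Fin 2) ℝ :=
  Matrix.of fun a c => if c.2 = 0 then U a c.1 else V a c.1

theorem det_pairMatrix (U V : κ × Fin 2 → κ → ℝ) :
    (pairMatrix U V).det = ∑ σ : Equiv.Perm (κ × Fin 2), ((Equiv.Perm.sign σ : ℤ) : ℝ) *
      ∏ i, U (σ (i, 0)) i * V (σ (i, 1)) i := by
  rw [Matrix.det_apply']
  refine Finset.sum_congr rfl fun σ _ => ?_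
  congr 1
  rw [Fintype.prod_prod_type]
  simp [pairMatrix, Fin.prod_univ_two]

/-- Expanding the differences chooses a swap or not in every pair. The chosen swaps are absorbed
into σ, whose sign changes by exactly the sign of the chosen term, so all 2^|κ| choices contribute
equally. -/
theorem pfSum_sub_transpose (A : κ × Fin 2 → κ × Fin 2 → ℝ) :
    pfSum (fun a b => A a b - A b a) = 2 ^ Fintype.card κ * pfSum A := by
  have key : ∀ σ : Equiv.Perm (κ × Fin 2),
      ∏ i, (A (σ (i, 0)) (σ (i, 1)) - A (σ (i, 1)) (σ (i, 0))) =
      ∑ s : κ → Equiv.Perm (Fin 2), ∏ i, (((Equiv.Perm.sign (s i) : ℤ) : ℝ) *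
        A (σ (i, s i 0)) (σ (i, s i 1))) := by
    intro σ
    rw [← Fintype.piFinset_univ, ← Finset.prod_univ_sum (fun _ : κ => Finset.univ)
      (fun i (s : Equiv.Perm (Fin 2)) => ((Equiv.Perm.sign s : ℤ) : ℝ) *
        A (σ (i, s 0)) (σ (i, s 1)))]
    refine Finset.prod_congr rfl fun i _ => ?_
    have huniv : (Finset.univ : Finset (Equiv.Perm (Fin 2))) = {1, Equiv.swap 0 1} := by decide
    have hne : (1 : Equiv.Perm (Fin 2)) ≠ Equiv.swap 0 1 := by decide
    rw [huniv, Finset.sum_pair hne, Equiv.Perm.sign_swap (by decide)]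
    simp
    ring
  unfold pfSum
  simp_rw [key, Finset.mul_sum]
  rw [Finset.sum_comm]
  have h2 : ∀ s : κ → Equiv.Perm (Fin 2),
      ∑ σ : Equiv.Perm (κ × Fin 2), ((Equiv.Perm.sign σ : ℤ) : ℝ) *
        ∏ i, (((Equiv.Perm.sign (s i) : ℤ) : ℝ) * A (σ (i, s i 0)) (σ (i, s i 1))) =
      ∑ σ : Equiv.Perm (κ × Fin 2), ((Equiv.Perm.sign σ : ℤ) : ℝ) *
        ∏ i, A (σ (i, 0)) (σ (i, 1)) := by
    intro s
    refine Fintype.sum_equiv (Equiv.mulRight (Equiv.prodCongrRight s)) _ _ fun σ => ?_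
    simp only [Equiv.coe_mulRight, Equiv.Perm.coe_mul, Function.comp_apply,
      Equiv.prodCongrRight_apply, Equiv.Perm.sign_mul, Equiv.Perm.sign_prodCongrRight,
      Finset.prod_mul_distrib]
    push_cast
    ring
  rw [Finset.sum_congr rfl fun s _ => h2 s]
  rw [Finset.sum_const, Finset.card_univ, nsmul_eq_mul, Fintype.card_fun, Fintype.card_perm,
    Fintype.card_fin, Finset.mul_sum]
  simp

/-- A permutation of κ moves columns two at a time, so its sign enters squared; a non-injective f
repeats a column. -/
theorem det_pairMatrix_comp (U V : κ × Fin 2 → κ → ℝ) (f : κ → κ) :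
    (pairMatrix (fun a i => U a (f i)) (fun a i => V a (f i))).det =
      if Function.Injective f then (pairMatrix U V).det else 0 := by
  split_ifs with hf
  · let τ : Equiv.Perm κ := Equiv.ofBijective f (Finite.injective_iff_bijective.mp hf)
    have : pairMatrix (fun a i => U a (f i)) (fun a i => V a (f i)) =
        (pairMatrix U V).submatrix id (Equiv.prodCongrLeft fun _ : Fin 2 => τ) := by
      ext a c
      rfl
    rw [this, Matrix.det_permute', Equiv.Perm.sign_prodCongrLeft]
    rcases Int.units_eq_one_or (Equiv.Perm.sign τ) with h | h <;> simp [h]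
  · obtain ⟨i, j, hij, hne⟩ : ∃ i j, f i = f j ∧ i ≠ j := by
      simpa [Function.Injective] using hf
    exact Matrix.det_zero_of_column_eq (i := (i, (0 : Fin 2))) (j := (j, 0)) (by simpa using hne)
      (fun a => by simp [pairMatrix, hij])

/-- Expanding the product of sums gives one determinant for each map κ → κ, and only the bijections
survive. Together with `pfSum_sub_transpose` this evaluates the Pfaffian of U Vᵀ - V Uᵀ as a
determinant. -/
theorem pfSum_sum_mul (U V : κ × Fin 2 → κ → ℝ) :
    pfSum (fun a b => ∑ l, U a l * V b l) =
      (Fintype.card κ).factorial * (pairMatrix U V).det := by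
  unfold pfSum
  have h1 : ∀ σ : Equiv.Perm (κ × Fin 2), ∏ i, ∑ l, U (σ (i, 0)) l * V (σ (i, 1)) l =
      ∑ f : κ → κ, ∏ i, U (σ (i, 0)) (f i) * V (σ (i, 1)) (f i) := by
    intro σ
    rw [Finset.prod_univ_sum, Fintype.piFinset_univ]
  simp_rw [h1, Finset.mul_sum]
  rw [Finset.sum_comm]
  have h2 := fun f : κ → κ => det_pairMatrix (fun a i => U a (f i)) (fun a i => V a (f i))
  simp_rw [← h2, det_pairMatrix_comp]
  rw [← Finset.sum_filter, Finset.sum_const, nsmul_eq_mul]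
  congr 2
  rw [← Fintype.card_perm (α := κ), ← Fintype.card_subtype]
  exact Fintype.card_congr (Equiv.ofBijective
    (fun f : {f : κ → κ // Function.Injective f} =>
      Equiv.ofBijective f.1 (Finite.injective_iff_bijective.mp f.2))
    ⟨fun f g h => Subtype.ext (by simpa using congrArg (fun e : Equiv.Perm κ => (e : κ → κ)) h),
      fun e => ⟨⟨e, e.injective⟩, by ext; rfl⟩⟩)

end Combinatorics

/-- The pair `(i, b)` corresponds to the index `2 * i + b`. -/
def pairEquiv (n : ℕ) : Fin n × Fin 2 ≃ Fin (2 * n) :=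
  finProdFinEquiv.trans (finCongr (mul_comm n 2))

theorem pairEquiv_val {n : ℕ} (i : Fin n) (b : Fin 2) :
    (pairEquiv n (i, b) : ℕ) = 2 * i + b := by
  simp [pairEquiv, add_comm]

theorem pairEquiv_zero {n : ℕ} (i : Fin n) : pairEquiv n (i, 0) = ⟨2 * i, by omega⟩ :=
  Fin.ext (by simp [pairEquiv_val])

theorem pairEquiv_one {n : ℕ} (i : Fin n) : pairEquiv n (i, 1) = ⟨2 * i + 1, by omega⟩ :=
  Fin.ext (by simp [pairEquiv_val])

theorem pfaffian_eq_pfSum {n : ℕ} (M : Matrix (Fin (2 * n)) (Fin (2 * n)) ℝ) :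
    pfaffian M = 1 / (2 ^ n * (n.factorial : ℝ)) *
      pfSum fun a b => M (pairEquiv n a) (pairEquiv n b) := by
  unfold pfaffian pfSum
  congr 1
  refine (Fintype.sum_equiv (pairEquiv n).permCongr _ _ fun σ => ?_).symm
  simp [Equiv.Perm.sign_permCongr, ← pairEquiv_zero, ← pairEquiv_one]

/-- The Pfaffian of a skew-symmetric matrix whose entries vanish between indices of equal
parity. -/
theorem pfaffian_eq_det {n : ℕ} (M : Matrix (Fin (2 * n)) (Fin (2 * n)) ℝ)
    (B : Matrix (Fin n) (Fin n) ℝ)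
    (h00 : ∀ i j, M (pairEquiv n (i, 0)) (pairEquiv n (j, 0)) = 0)
    (h11 : ∀ i j, M (pairEquiv n (i, 1)) (pairEquiv n (j, 1)) = 0)
    (h01 : ∀ i j, M (pairEquiv n (i, 0)) (pairEquiv n (j, 1)) = B i j)
    (h10 : ∀ i j, M (pairEquiv n (j, 1)) (pairEquiv n (i, 0)) = -B i j) :
    pfaffian M = B.det := by
  -- With this choice M = U Vᵀ - V Uᵀ, and the matrix of paired columns is block diagonal with
  -- blocks 1 and Bᵀ.
  let U : Fin n × Fin 2 → Fin n → ℝ := fun a l => if a.2 = 0 then (if a.1 = l then 1 else 0) else 0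
  let V : Fin n × Fin 2 → Fin n → ℝ := fun a l => if a.2 = 0 then 0 else B l a.1
  have hM : (fun a b => M (pairEquiv n a) (pairEquiv n b)) =
      fun a b => (∑ l, U a l * V b l) - ∑ l, U b l * V a l := by
    funext ⟨i, b⟩ ⟨j, c⟩
    fin_cases b <;> fin_cases c <;> simp [U, V, h00, h01, h10, h11]
  have hdet : (pairMatrix U V).det = B.det := by
    have : pairMatrix U V = Matrix.blockDiagonal
        (fun b : Fin 2 => if b = 0 then (1 : Matrix (Fin n) (Fin n) ℝ) else B.transpose) := by
      ext ⟨i, b⟩ ⟨j, c⟩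
      fin_cases b <;> fin_cases c <;>
        simp [U, V, pairMatrix, Matrix.blockDiagonal_apply, Matrix.one_apply]
    rw [this, Matrix.det_blockDiagonal]
    simp
  rw [pfaffian_eq_pfSum, hM, pfSum_sub_transpose (fun a b => ∑ l, U a l * V b l), pfSum_sum_mul,
    hdet, Fintype.card_fin]
  have : (n.factorial : ℝ) ≠ 0 := by positivity
  field_simp

theorem pfSum_sign (n : ℕ) :
    pfSum (fun a b : Fin n × Fin 2 => Real.sign ((pairEquiv n b : ℝ) - (pairEquiv n a : ℝ))) =
      2 ^ n * n.factorial := by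
  -- A factorization sgn(b - a) = (U Vᵀ - V Uᵀ)(a, b) for which the matrix of paired columns is
  -- lower triangular with unit diagonal.
  let U : Fin n × Fin 2 → Fin n → ℝ := fun a l => if a.1 = l then 1 else 0
  let V : Fin n × Fin 2 → Fin n → ℝ := fun a l =>
    if 2 * (l : ℕ) + 1 ≤ (pairEquiv n a : ℕ) then 1 else 0
  have hM : (fun a b : Fin n × Fin 2 =>
        Real.sign ((pairEquiv n b : ℝ) - (pairEquiv n a : ℝ))) =
      fun a b => (∑ l, U a l * V b l) - ∑ l, U b l * V a l := by
    funext a b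
    have hs : ∀ k m : ℕ, Real.sign ((m : ℝ) - k) =
        if k < m then 1 else if m < k then -1 else 0 := by
      intro k m
      split_ifs with h1 h2
      · exact Real.sign_of_pos (sub_pos.mpr (by exact_mod_cast h1))
      · exact Real.sign_of_neg (sub_neg.mpr (by exact_mod_cast h2))
      · simp [le_antisymm (not_lt.mp h1) (not_lt.mp h2)]
    rw [hs]
    obtain ⟨i, d⟩ := a
    obtain ⟨j, c⟩ := b
    have hd := d.isLt
    have hc := c.isLt
    simp only [U, V, ite_mul, one_mul, zero_mul, Finset.sum_ite_eq, Finset.mem_univ, if_true,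
      pairEquiv_val]
    split_ifs <;> first | omega | norm_num
  have hdet : (pairMatrix U V).det = 1 := by
    have : pairMatrix U V = ((pairMatrix U V).submatrix (pairEquiv n).symm
        (pairEquiv n).symm).submatrix (pairEquiv n) (pairEquiv n) := by
      ext; simp
    rw [this, Matrix.det_submatrix_equiv_self, Matrix.det_of_isLowerTriangular]
    · refine Finset.prod_eq_one fun i _ => ?_
      obtain ⟨⟨i, b⟩, rfl⟩ := (pairEquiv n).surjective i
      have hb := pairEquiv_val i b
      fin_cases b <;> simp [pairMatrix, U, V, pairEquiv_val]
    · intro i j hij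
      obtain ⟨⟨i, b⟩, rfl⟩ := (pairEquiv n).surjective i
      obtain ⟨⟨j, c⟩, rfl⟩ := (pairEquiv n).surjective j
      have hlt : 2 * (i : ℕ) + b < 2 * j + c := by
        rw [← pairEquiv_val, ← pairEquiv_val]; exact hij
      have hb := b.isLt
      have hc := c.isLt
      by_cases h0 : c = 0
      · have : ¬ i = j := by rintro rfl; subst h0; simp at hlt
        simp [pairMatrix, U, h0, this]
      · have h1 : (c : ℕ) = 1 := by have : (c : ℕ) ≠ 0 := fun h => h0 (Fin.ext h); omega
        have : 2 * (i : ℕ) + b ≤ 2 * j := by omega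
        simpa [pairMatrix, V, h0, pairEquiv_val] using this
  rw [hM, pfSum_sub_transpose (fun a b => ∑ l, U a l * V b l), pfSum_sum_mul, hdet,
    Fintype.card_fin, mul_one]

theorem pfSum_perm {κ : Type*} [Fintype κ] [DecidableEq κ] (M : κ × Fin 2 → κ × Fin 2 → ℝ)
    (ρ : Equiv.Perm (κ × Fin 2)) :
    pfSum (fun a b => M (ρ a) (ρ b)) = ((Equiv.Perm.sign ρ : ℤ) : ℝ) * pfSum M := by
  unfold pfSum
  rw [Finset.mul_sum]
  refine Fintype.sum_equiv (Equiv.mulLeft ρ) _ _ fun σ => ?_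
  rcases Int.units_eq_one_or (Equiv.Perm.sign ρ) with h | h <;> simp [h]

/-- Both the Vandermonde determinant and the sum of signs are multiplied by the sign of a
permutation of the nodes. Sorting therefore reduces the claim to increasing nodes, where
`pfSum_sign` applies; if two nodes coincide, both sides vanish. -/
theorem abs_vandermonde_mul {n : ℕ} (x : Fin (2 * n) → ℝ) :
    |(Matrix.vandermonde x).det| * (2 ^ n * n.factorial) = (Matrix.vandermonde x).det *
      pfSum fun a b => Real.sign (x (pairEquiv n b) - x (pairEquiv n a)) := by
  by_cases hx : Function.Injective x
  · let ρ := Tuple.sort x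
    have hmono : StrictMono (x ∘ ρ) :=
      (Tuple.monotone_sort x).strictMono_of_injective (hx.comp ρ.injective)
    have hpos : 0 < (Matrix.vandermonde (x ∘ ρ)).det := by
      rw [Matrix.det_vandermonde]
      exact Finset.prod_pos fun i _ => Finset.prod_pos fun j hj =>
        sub_pos.mpr (hmono (Finset.mem_Ioi.mp hj))
    have hperm : (Matrix.vandermonde (x ∘ ρ)).det =
        ((Equiv.Perm.sign ρ : ℤ) : ℝ) * (Matrix.vandermonde x).det := by
      rw [← Matrix.det_permute]; rfl
    have hpf : pfSum (fun a b => Real.sign (x (ρ (pairEquiv n b)) - x (ρ (pairEquiv n a)))) =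
        2 ^ n * n.factorial := by
      rw [← pfSum_sign]
      congr 1
      funext a b
      rcases lt_trichotomy (pairEquiv n a) (pairEquiv n b) with h | h | h
      · rw [Real.sign_of_pos (sub_pos.mpr (show x (ρ _) < x (ρ _) from hmono h)),
          Real.sign_of_pos (sub_pos.mpr (by exact_mod_cast h))]
      · simp [h]
      · rw [Real.sign_of_neg (sub_neg.mpr (show x (ρ _) < x (ρ _) from hmono h)),
          Real.sign_of_neg (sub_neg.mpr (by exact_mod_cast h))]
    have hpf2 := pfSum_perm (fun a b => Real.sign (x (pairEquiv n b) - x (pairEquiv n a)))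
      ((pairEquiv n).symm.permCongr ρ)
    simp only [Equiv.permCongr_apply, Equiv.symm_symm, Equiv.apply_symm_apply,
      Equiv.Perm.sign_permCongr] at hpf2
    rw [hpf] at hpf2
    have habs : |(Matrix.vandermonde x).det| =
        ((Equiv.Perm.sign ρ : ℤ) : ℝ) * (Matrix.vandermonde x).det := by
      rw [← hperm, ← abs_of_pos hpos, hperm, abs_mul]
      rcases Int.units_eq_one_or (Equiv.Perm.sign ρ) with h | h <;> simp [h]
    rw [habs, hpf2]
    rcases Int.units_eq_one_or (Equiv.Perm.sign ρ) with h | h <;> simp [h]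
  · have : (Matrix.vandermonde x).det = 0 := by
      rw [Matrix.det_vandermonde_eq_zero_iff]
      simpa [Function.Injective, and_comm] using hx
    simp [this]

/-! ### De Bruijn's integration formulas -/

theorem det_pairMatrix_mul {κ : Type*} [Fintype κ] [DecidableEq κ] (w : κ → ℝ)
    (U V : κ × Fin 2 → κ → ℝ) :
    (pairMatrix (fun a i => w i * U a i) V).det = (∏ i, w i) * (pairMatrix U V).det := by
  simp_rw [det_pairMatrix, Finset.mul_sum, mul_assoc, Finset.prod_mul_distrib]
  refine Finset.sum_congr rfl fun σ _ => ?_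
  ring

/-- A column operation within each pair. It replaces the value at a shifted node by a difference
quotient at the cost of a factor t. -/
theorem det_pairMatrix_add {κ : Type*} [Fintype κ] [DecidableEq κ] (t : ℝ)
    (U V : κ × Fin 2 → κ → ℝ) :
    (pairMatrix U (fun a i => U a i + t * V a i)).det =
      t ^ Fintype.card κ * (pairMatrix U V).det := by
  have : pairMatrix U (fun a i => U a i + t * V a i) =
      pairMatrix U V * Matrix.kroneckerMap (· * ·) (1 : Matrix κ κ ℝ) !![1, 1; 0, t] := by
    ext a ⟨i, b⟩
    rw [Matrix.mul_apply, Fintype.sum_prod_type]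
    fin_cases b <;>
      simp [pairMatrix, Fin.sum_univ_two, Matrix.one_apply, mul_comm]
  rw [this, Matrix.det_mul, Matrix.det_kronecker]
  simp [Matrix.det_fin_two, mul_comm]

/-- In every Leibniz term the variable x_i occurs only in the factor with index i, so the integral
of the term factorizes. -/
theorem integral_det_pairMatrix {κ α : Type*} [Fintype κ] [DecidableEq κ] [MeasurableSpace α]
    (μ : Measure α) [SigmaFinite μ] (U V : κ × Fin 2 → α → ℝ)
    (h : ∀ a b, Integrable (fun x => U a x * V b x) μ) :
    Integrable (fun x : κ → α => (pairMatrix (fun a i => U a (x i)) (fun a i => V a (x i))).det)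
      (Measure.pi fun _ => μ) ∧
    ∫ x : κ → α, (pairMatrix (fun a i => U a (x i)) (fun a i => V a (x i))).det
      ∂(Measure.pi fun _ => μ) = pfSum fun a b => ∫ x, U a x * V b x ∂μ := by
  simp_rw [det_pairMatrix]
  have hi : ∀ σ : Equiv.Perm (κ × Fin 2), Integrable (fun x : κ → α =>
      ((Equiv.Perm.sign σ : ℤ) : ℝ) * ∏ i, U (σ (i, 0)) (x i) * V (σ (i, 1)) (x i))
      (Measure.pi fun _ => μ) := fun σ =>
    (Integrable.fintype_prod (f := fun i x => U (σ (i, 0)) x * V (σ (i, 1)) x)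
      fun i => h _ _).const_mul _
  refine ⟨integrable_finsetSum _ fun σ _ => hi σ, ?_⟩
  rw [integral_finsetSum _ fun σ _ => hi σ]
  refine Finset.sum_congr rfl fun σ _ => ?_
  rw [integral_const_mul,
    integral_fintype_prod_eq_prod (fun i x => U (σ (i, 0)) x * V (σ (i, 1)) x)]

theorem prod_ite_lt {N : ℕ} (F : Fin N → Fin N → ℝ) (t : ℝ) :
    ∏ i, ∏ j, (if i < j then F i j else if i = j then t else 1) =
      t ^ N * ∏ i, ∏ j ∈ Finset.Ioi i, F i j := by
  have : ∀ i : Fin N, ∏ j, (if i < j then F i j else if i = j then t else 1) =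
      t * ∏ j ∈ Finset.Ioi i, F i j := by
    intro i
    have h : ∀ j, (if i < j then F i j else if i = j then t else 1) =
        (if i = j then t else 1) * if i < j then F i j else 1 := by
      intro j
      split_ifs with h1 h2 <;> first | (subst h2; exact absurd h1 (lt_irrefl _)) | simp
    rw [Finset.prod_congr rfl fun j _ => h j, Finset.prod_mul_distrib, Finset.prod_ite_eq,
      ← Finset.prod_filter]
    simp only [Finset.mem_univ, if_true]
    congr 2
    ext j
    simp
  rw [Finset.prod_congr rfl fun i _ => this i, Finset.prod_mul_distrib]
  simp

theorem pairEquiv_lt {n : ℕ} (i j : Fin n) (b c : Fin 2) :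
    pairEquiv n (i, b) < pairEquiv n (j, c) ↔ i < j ∨ i = j ∧ b < c := by
  have hb := b.isLt
  have hc := c.isLt
  rw [Fin.lt_def, pairEquiv_val, pairEquiv_val, Fin.lt_def, Fin.ext_iff, Fin.lt_def]
  omega

/-- The nodes are x_i and x_i + t. The two nodes of one pair contribute t, and two distinct pairs
contribute four differences. -/
theorem det_vandermonde_pairs {N : ℕ} (x : Fin N → ℝ) (t : ℝ) :
    (Matrix.vandermonde fun c : Fin (2 * N) =>
        x ((pairEquiv N).symm c).1 + if ((pairEquiv N).symm c).2 = 0 then 0 else t).det =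
      t ^ N * ∏ i, ∏ j ∈ Finset.Ioi i,
        (x j - x i) ^ 2 * ((x j + t - x i) * (x j - x i - t)) := by
  rw [Matrix.det_vandermonde, ← prod_ite_lt]
  have h : ∀ (m : ℕ) (f : Fin m → Fin m → ℝ), ∏ i, ∏ j ∈ Finset.Ioi i, f i j =
      ∏ i, ∏ j, if i < j then f i j else 1 := by
    intro m f
    refine Finset.prod_congr rfl fun i _ => ?_
    rw [← Finset.prod_filter]
    congr 1
    ext j
    simp
  rw [h, ← (pairEquiv N).prod_comp, Fintype.prod_prod_type]
  refine Finset.prod_congr rfl fun i _ => ?_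
  simp_rw [← (pairEquiv N).prod_comp (fun j => if _ < j then _ else _)]
  simp_rw [Fintype.prod_prod_type]
  rw [Finset.prod_comm]
  refine Finset.prod_congr rfl fun j _ => ?_
  simp only [Fin.prod_univ_two, pairEquiv_lt, Equiv.symm_apply_apply]
  rcases lt_trichotomy i j with hij | hij | hij
  · simp [hij]
    ring
  · subst hij
    simp
  · simp [hij.not_gt, hij.ne']

/-- The confluent Vandermonde determinant with all nodes doubled. -/
theorem det_confluent {N : ℕ} (P : ℕ → ℝ[X]) (hP : IsMonicFamily P) (x : Fin N → ℝ) :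
    (pairMatrix (fun a i => (P (pairEquiv N a)).eval (x i))
      (fun a i => (P (pairEquiv N a)).derivative.eval (x i))).det =
      ∏ i, ∏ j ∈ Finset.Ioi i, (x j - x i) ^ 4 := by
  -- Split each double node into x_i and x_i + t and divide by t^N; letting t tend to 0 then
  -- produces the derivatives.
  have key : ∀ t : ℝ, t ≠ 0 → (pairMatrix (fun a i => (P (pairEquiv N a)).eval (x i))
      (fun a i => t⁻¹ * ((P (pairEquiv N a)).eval (x i + t) -
        (P (pairEquiv N a)).eval (x i)))).det =
      ∏ i, ∏ j ∈ Finset.Ioi i, (x j - x i) ^ 2 * ((x j + t - x i) * (x j - x i - t)) := by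
    intro t ht
    have h1 := det_vandermonde_pairs x t
    rw [Matrix.det_eval_matrixOfPolynomials_eq_det_vandermonde _
      (fun c : Fin (2 * N) => P c) (fun c => (hP c).2) (fun c => (hP c).1),
      ← Matrix.det_submatrix_equiv_self (pairEquiv N), ← Matrix.det_transpose] at h1
    have h2 : ((Matrix.of fun (i j : Fin (2 * N)) => (P j).eval
        (x ((pairEquiv N).symm i).1 + if ((pairEquiv N).symm i).2 = 0 then 0 else t)).submatrix
          (pairEquiv N) (pairEquiv N)).transpose =
        pairMatrix (fun a i => (P (pairEquiv N a)).eval (x i))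
          (fun a i => (P (pairEquiv N a)).eval (x i) + t * (t⁻¹ *
            ((P (pairEquiv N a)).eval (x i + t) - (P (pairEquiv N a)).eval (x i)))) := by
      ext a ⟨i, b⟩
      fin_cases b <;> simp [pairMatrix, ht]
    rw [h2, det_pairMatrix_add, Fintype.card_fin] at h1
    exact mul_left_cancel₀ (pow_ne_zero N ht) h1
  have hl : Filter.Tendsto (fun t : ℝ =>
      (pairMatrix (fun a i => (P (pairEquiv N a)).eval (x i))
      (fun a i => t⁻¹ * ((P (pairEquiv N a)).eval (x i + t) -
        (P (pairEquiv N a)).eval (x i)))).det) (nhdsWithin 0 {0}ᶜ)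
      (nhds (pairMatrix (fun a i => (P (pairEquiv N a)).eval (x i))
        (fun a i => (P (pairEquiv N a)).derivative.eval (x i))).det) := by
    simp_rw [det_pairMatrix]
    refine tendsto_finsetSum _ fun σ _ => Filter.Tendsto.const_mul _ ?_
    refine tendsto_finsetProd _ fun i _ => Filter.Tendsto.const_mul _ ?_
    simpa using ((P (pairEquiv N (σ (i, 1)))).hasDerivAt (x i)).tendsto_slope_zero
  have hr : Filter.Tendsto (fun t : ℝ => ∏ i, ∏ j ∈ Finset.Ioi i,
      (x j - x i) ^ 2 * ((x j + t - x i) * (x j - x i - t))) (nhdsWithin 0 {0}ᶜ)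
      (nhds (∏ i, ∏ j ∈ Finset.Ioi i, (x j - x i) ^ 4)) := by
    have hc : Continuous (fun t : ℝ => ∏ i, ∏ j ∈ Finset.Ioi i,
      (x j - x i) ^ 2 * ((x j + t - x i) * (x j - x i - t))) := by fun_prop
    have := (hc.tendsto 0).mono_left (nhdsWithin_le_nhds (s := {0}ᶜ))
    convert this using 2
    refine Finset.prod_congr rfl fun i _ => Finset.prod_congr rfl fun j _ => ?_
    ring
  refine tendsto_nhds_unique (hl.congr' ?_) hr
  filter_upwards [self_mem_nhdsWithin] with t ht using key t ht

/-! ### Gaussian integrability and the case β = 4. -/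

theorem integrable_gauss_poly {b : ℝ} (hb : 0 < b) (p : ℝ[X]) :
    Integrable fun x : ℝ => Real.exp (-b * x ^ 2) * p.eval x := by
  induction p using Polynomial.induction_on' with
  | add p q hp hq =>
    simp only [eval_add, mul_add]
    exact hp.add hq
  | monomial n a =>
    have := (integrable_rpow_mul_exp_neg_mul_sq hb
      (show (-1 : ℝ) < n by linarith [(Nat.cast_nonneg n : (0 : ℝ) ≤ n)])).const_mul a
    refine this.congr (Filter.Eventually.of_forall fun x => ?_)
    simp [Real.rpow_natCast]
    ring

theorem integrable_exp_neg_sq_poly (p : ℝ[X]) :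
    Integrable fun x : ℝ => Real.exp (-x ^ 2) * p.eval x := by
  simpa using integrable_gauss_poly one_pos p

theorem integrable_exp_neg_sq_half_poly (p : ℝ[X]) :
    Integrable fun x : ℝ => Real.exp (-x ^ 2 / 2) * p.eval x := by
  have := integrable_gauss_poly (b := 1 / 2) (by norm_num) p
  refine this.congr (Filter.Eventually.of_forall fun x => ?_)
  simp only
  congr 2
  ring

/-- The integral of the unnormalised eigenvalue density over `D × ⋯ × D`. -/
def eigIntegral (β N : ℕ) (D : Set ℝ) : ℝ :=
  ∫ l in Set.univ.pi fun _ : Fin N => D, eigWeight β N l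

theorem eigWeight_four {N : ℕ} (P : ℕ → ℝ[X]) (hP : IsMonicFamily P) (l : Fin N → ℝ) :
    eigWeight 4 N l = (pairMatrix
      (fun a i => Real.exp (-2 * l i ^ 2) * (P (pairEquiv N a)).eval (l i))
      (fun a i => (P (pairEquiv N a)).derivative.eval (l i))).det := by
  rw [det_pairMatrix_mul (fun i => Real.exp (-2 * l i ^ 2)), det_confluent P hP, eigWeight]
  congr 1
  · refine Finset.prod_congr rfl fun j _ => ?_
    congr 1
    push_cast
    ring
  · refine Finset.prod_congr rfl fun j _ => Finset.prod_congr rfl fun k _ => ?_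
    rw [Even.pow_abs (by decide)]

theorem isMonicFamily_X_pow : IsMonicFamily fun j => (X ^ j : ℝ[X]) :=
  fun j => ⟨monic_X_pow j, natDegree_X_pow j⟩

theorem integrable_mul_gauss {b : ℝ} (hb : 0 < b) (p q : ℝ[X]) :
    Integrable fun x : ℝ => Real.exp (-b * x ^ 2) * p.eval x * q.eval x := by
  simpa [mul_assoc] using integrable_gauss_poly hb (p * q)

theorem integrable_eigWeight_four (N : ℕ) : Integrable (eigWeight 4 N) := by
  have := (integral_det_pairMatrix (κ := Fin N) volume
    (fun a x => Real.exp (-2 * x ^ 2) * (X ^ (pairEquiv N a : ℕ) : ℝ[X]).eval x)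
    (fun a x => (derivative (X ^ (pairEquiv N a : ℕ) : ℝ[X])).eval x)
    (fun a b => integrable_mul_gauss two_pos _ _)).1
  rw [← volume_pi] at this
  refine this.congr (Filter.Eventually.of_forall fun l => ?_)
  exact (eigWeight_four _ isMonicFamily_X_pow l).symm

/-- De Bruijn's formula for `β = 4`. -/
theorem eigIntegral_four (N : ℕ) (D : Set ℝ) (P : ℕ → ℝ[X]) (hP : IsMonicFamily P) :
    eigIntegral 4 N D = 2 ^ N * N.factorial *
      pfaffian (Matrix.of fun j k : Fin (2 * N) => skew4 D (P j) (P k)) := by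
  have hint : ∀ p q : ℝ[X], Integrable (fun x : ℝ => Real.exp (-2 * x ^ 2) * p.eval x * q.eval x)
      (volume.restrict D) := fun p q => (integrable_mul_gauss two_pos p q).restrict
  unfold eigIntegral
  rw [volume_pi, Measure.restrict_pi_pi]
  simp_rw [eigWeight_four P hP]
  rw [(integral_det_pairMatrix (κ := Fin N) (volume.restrict D)
    (fun a x => Real.exp (-2 * x ^ 2) * (P (pairEquiv N a)).eval x)
    (fun a x => (P (pairEquiv N a)).derivative.eval x) (fun a b => hint _ _)).2,
    pfaffian_eq_pfSum]
  have hs : (fun a b : Fin N × Fin 2 => (Matrix.of fun j k : Fin (2 * N) => skew4 D (P j) (P k))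
      (pairEquiv N a) (pairEquiv N b)) = fun a b =>
      (1 / 2) * (∫ x in D, Real.exp (-2 * x ^ 2) * (P (pairEquiv N a)).eval x *
        (P (pairEquiv N b)).derivative.eval x) -
      (1 / 2) * (∫ x in D, Real.exp (-2 * x ^ 2) * (P (pairEquiv N b)).eval x *
        (P (pairEquiv N a)).derivative.eval x) := by
    funext a b
    simp only [Matrix.of_apply, skew4]
    rw [← mul_sub, ← integral_sub (hint _ _) (hint _ _)]
    congr 2
    funext x
    ring
  rw [hs, pfSum_sub_transpose fun a b : Fin N × Fin 2 =>
      (1 / 2) * (∫ x in D, Real.exp (-2 * x ^ 2) * (P (pairEquiv N a)).eval x *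
        (P (pairEquiv N b)).derivative.eval x), Fintype.card_fin]
  have hh : ∀ M : Fin N × Fin 2 → Fin N × Fin 2 → ℝ,
      2 ^ N * pfSum (fun a b => 1 / 2 * M a b) = pfSum M := by
    intro M
    unfold pfSum
    rw [Finset.mul_sum]
    refine Finset.sum_congr rfl fun σ _ => ?_
    rw [Finset.prod_mul_distrib, Finset.prod_const, Finset.card_univ, Fintype.card_fin]
    rw [one_div, inv_pow]
    field_simp
  rw [hh]
  have : (N.factorial : ℝ) ≠ 0 := by positivity
  field_simp

/-! ### The case β = 1. -/

theorem measurable_sign : Measurable Real.sign := by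
  unfold Real.sign
  exact Measurable.ite measurableSet_Iio measurable_const
    (Measurable.ite measurableSet_Ioi measurable_const measurable_const)

theorem abs_sign_le_one (x : ℝ) : ‖Real.sign x‖ ≤ 1 := by
  rcases Real.sign_apply_eq x with h | h | h <;> simp [h]

theorem integral_pi_comp_equiv {ι ι' : Type*} [Fintype ι] [Fintype ι'] (ν : Measure ℝ)
    [SigmaFinite ν] (e : ι ≃ ι') (f : (ι → ℝ) → ℝ) :
    ∫ x : ι' → ℝ, f (x ∘ e) ∂(Measure.pi fun _ => ν) = ∫ x, f x ∂(Measure.pi fun _ => ν) := by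
  rw [← (measurePreserving_piCongrLeft (fun _ : ι' => ν) e).integral_comp']
  congr 1
  funext x
  congr 1
  funext i
  exact MeasurableEquiv.piCongrLeft_apply_apply (β := fun _ => ℝ) e x i

/-- Functions on `κ × Fin 2` are functions on `κ` with values in pairs. -/
def pairsMeasurableEquiv (κ : Type*) : (κ → ℝ × ℝ) ≃ᵐ (κ × Fin 2 → ℝ) where
  toFun z c := if c.2 = 0 then (z c.1).1 else (z c.1).2
  invFun y i := (y (i, 0), y (i, 1))
  left_inv z := by funext i; simp
  right_inv y := by
    funext ⟨i, b⟩
    fin_cases b <;> simp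
  measurable_toFun := by
    refine measurable_pi_lambda _ fun c => ?_
    change Measurable fun z : κ → ℝ × ℝ => if c.2 = 0 then (z c.1).1 else (z c.1).2
    split_ifs
    · exact measurable_fst.comp (measurable_pi_apply _)
    · exact measurable_snd.comp (measurable_pi_apply _)
  measurable_invFun := by
    refine measurable_pi_lambda _ fun i => ?_
    exact (measurable_pi_apply _).prodMk (measurable_pi_apply _)

theorem measurePreserving_pairs {κ : Type*} [Fintype κ] (ν : Measure ℝ) [SigmaFinite ν] :
    MeasurePreserving (pairsMeasurableEquiv κ) (Measure.pi fun _ => ν.prod ν)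
      (Measure.pi fun _ => ν) where
  measurable := (pairsMeasurableEquiv κ).measurable
  map_eq := by
    refine (Measure.pi_eq fun s _ => ?_).symm
    rw [MeasurableEquiv.map_apply]
    have : pairsMeasurableEquiv κ ⁻¹' Set.univ.pi s =
        Set.univ.pi fun i => s (i, 0) ×ˢ s (i, 1) := by
      ext z
      simp only [Set.mem_preimage, Set.mem_pi, Set.mem_univ, true_imp_iff, Prod.forall,
        Fin.forall_fin_two, Set.mem_prod]
      rfl
    rw [this, Measure.pi_pi, Fintype.prod_prod_type]
    simp [Measure.prod_prod, Fin.prod_univ_two]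

theorem skew1_integrable (D : Set ℝ) (f g : ℝ[X]) :
    Integrable (fun z : ℝ × ℝ => Real.exp (-z.1 ^ 2 / 2) * f.eval z.1 *
      (Real.exp (-z.2 ^ 2 / 2) * g.eval z.2 * Real.sign (z.2 - z.1)))
      ((volume.restrict D).prod (volume.restrict D)) := by
  have h := ((integrable_exp_neg_sq_half_poly f).restrict (s := D)).mul_prod
    ((integrable_exp_neg_sq_half_poly g).restrict (s := D))
  have h2 := h.mul_bdd (c := 1) (g := fun z : ℝ × ℝ => Real.sign (z.2 - z.1))
    (measurable_sign.comp (measurable_snd.sub measurable_fst)).aestronglyMeasurable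
    (Filter.Eventually.of_forall fun z => abs_sign_le_one _)
  refine h2.congr (Filter.Eventually.of_forall fun z => ?_)
  simp only
  ring

theorem skew1_eq_integral_prod (D : Set ℝ) (f g : ℝ[X]) :
    skew1 D f g = (1 / 2) * ∫ z : ℝ × ℝ, Real.exp (-z.1 ^ 2 / 2) * f.eval z.1 *
      (Real.exp (-z.2 ^ 2 / 2) * g.eval z.2 * Real.sign (z.2 - z.1))
      ∂((volume.restrict D).prod (volume.restrict D)) := by
  rw [integral_prod _ (skew1_integrable D f g), skew1]
  simp_rw [integral_const_mul]

theorem skew1_swap (D : Set ℝ) (f g : ℝ[X]) : skew1 D f g = -skew1 D g f := by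
  rw [skew1_eq_integral_prod, skew1_eq_integral_prod, ← integral_prod_swap, ← mul_neg,
    ← integral_neg]
  congr 2
  funext z
  have : Real.sign (z.1 - z.2) = -Real.sign (z.2 - z.1) := by rw [← Real.sign_neg, neg_sub]
  simp only [Prod.fst_swap, Prod.snd_swap, this]
  ring

theorem abs_vandermonde_eq_prod {N : ℕ} (l : Fin N → ℝ) :
    ∏ j : Fin N, ∏ k ∈ Finset.Ioi j, |l k - l j| = |(Matrix.vandermonde l).det| := by
  rw [Matrix.det_vandermonde, Finset.abs_prod]
  simp_rw [Finset.abs_prod]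

theorem eigWeight_one {N : ℕ} (l : Fin N → ℝ) :
    eigWeight 1 N l = (∏ j, Real.exp (-l j ^ 2 / 2)) * |(Matrix.vandermonde l).det| := by
  rw [eigWeight, ← abs_vandermonde_eq_prod]
  simp

theorem weight_mul_vandermonde {N : ℕ} (l : Fin N → ℝ) :
    (∏ j, Real.exp (-l j ^ 2 / 2)) * (Matrix.vandermonde l).det =
      ∑ σ : Equiv.Perm (Fin N), ((Equiv.Perm.sign σ : ℤ) : ℝ) *
        ∏ i, Real.exp (-l i ^ 2 / 2) * (X ^ (σ i : ℕ) : ℝ[X]).eval (l i) := by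
  rw [← Matrix.det_transpose, Matrix.det_apply', Finset.mul_sum]
  refine Finset.sum_congr rfl fun σ _ => ?_
  rw [Finset.prod_mul_distrib]
  simp [Matrix.vandermonde_apply]
  ring

theorem integrable_weight_mul_vandermonde (N : ℕ) (ν : Measure ℝ) [SigmaFinite ν]
    (hν : ν ≤ volume) :
    Integrable (fun l : Fin N → ℝ => (∏ j, Real.exp (-l j ^ 2 / 2)) *
      (Matrix.vandermonde l).det) (Measure.pi fun _ => ν) := by
  simp_rw [weight_mul_vandermonde]
  exact integrable_finsetSum _ fun σ _ => (Integrable.fintype_prod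
    (f := fun (i : Fin N) x => Real.exp (-x ^ 2 / 2) * (X ^ (σ i : ℕ) : ℝ[X]).eval x)
    fun i => (integrable_exp_neg_sq_half_poly _).mono_measure hν).const_mul _

theorem integrable_eigWeight_one (N : ℕ) : Integrable (eigWeight 1 N) := by
  have := (integrable_weight_mul_vandermonde N volume le_rfl).abs
  rw [← volume_pi] at this
  refine this.congr (Filter.Eventually.of_forall fun l => ?_)
  simp only
  rw [eigWeight_one, abs_mul, abs_of_pos (Finset.prod_pos fun j _ => Real.exp_pos _)]

theorem det_pairMatrix_eq_vandermonde {n : ℕ} (P : ℕ → ℝ[X]) (hP : IsMonicFamily P)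
    (y : Fin n × Fin 2 → ℝ) :
    (pairMatrix (fun a i => (P (pairEquiv n a)).eval (y (i, 0)))
      (fun a i => (P (pairEquiv n a)).eval (y (i, 1)))).det =
      (Matrix.vandermonde (y ∘ (pairEquiv n).symm)).det := by
  rw [Matrix.det_eval_matrixOfPolynomials_eq_det_vandermonde _
      (fun c : Fin (2 * n) => P c) (fun c => (hP c).2) (fun c => (hP c).1),
      ← Matrix.det_submatrix_equiv_self (pairEquiv n), ← Matrix.det_transpose]
  congr 1
  ext ⟨i, b⟩ a
  fin_cases b <;> simp [pairMatrix]

/-- The integral of `∏ e^{-x²/2} Δ(x) ∏ sgn(x_{i,1} - x_{i,0})`. -/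
theorem integral_vandermonde_mul_sign (n : ℕ) (D : Set ℝ) (P : ℕ → ℝ[X])
    (hP : IsMonicFamily P) :
    ∫ y : Fin n × Fin 2 → ℝ, (∏ c, Real.exp (-y c ^ 2 / 2)) *
      (Matrix.vandermonde (y ∘ (pairEquiv n).symm)).det * ∏ i, Real.sign (y (i, 1) - y (i, 0))
      ∂(Measure.pi fun _ => volume.restrict D) =
    pfSum fun a b : Fin n × Fin 2 => 2 * skew1 D (P (pairEquiv n a)) (P (pairEquiv n b)) := by
  -- Each pair of variables is a single integration variable in ℝ × ℝ, whose weights and sign are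
  -- attached to its first column.
  have h := (integral_det_pairMatrix (κ := Fin n)
    ((volume.restrict D).prod (volume.restrict D))
    (fun a (z : ℝ × ℝ) => (Real.exp (-z.1 ^ 2 / 2) * Real.exp (-z.2 ^ 2 / 2) *
      Real.sign (z.2 - z.1)) * (P (pairEquiv n a)).eval z.1)
    (fun a z => (P (pairEquiv n a)).eval z.2)
    (fun a b => (skew1_integrable D (P (pairEquiv n a)) (P (pairEquiv n b))).congr
      (Filter.Eventually.of_forall fun z => by simp only; ring))).2
  have hr : (fun a b : Fin n × Fin 2 => 2 * skew1 D (P (pairEquiv n a)) (P (pairEquiv n b))) =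
      fun a b => ∫ z : ℝ × ℝ, (Real.exp (-z.1 ^ 2 / 2) * Real.exp (-z.2 ^ 2 / 2) *
        Real.sign (z.2 - z.1)) * (P (pairEquiv n a)).eval z.1 * (P (pairEquiv n b)).eval z.2
        ∂((volume.restrict D).prod (volume.restrict D)) := by
    funext a b
    rw [skew1_eq_integral_prod, ← mul_assoc]
    norm_num
    congr 1
    funext z
    ring
  rw [hr, ← h, ← (measurePreserving_pairs (κ := Fin n) (volume.restrict D)).integral_comp']
  congr 1
  funext z
  have h0 : ∀ i, pairsMeasurableEquiv (Fin n) z (i, 0) = (z i).1 := fun i => rfl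
  have h1 : ∀ i, pairsMeasurableEquiv (Fin n) z (i, 1) = (z i).2 := fun i => rfl
  rw [det_pairMatrix_mul (fun i => Real.exp (-(z i).1 ^ 2 / 2) * Real.exp (-(z i).2 ^ 2 / 2) *
      Real.sign ((z i).2 - (z i).1))
    (fun a i => (P (pairEquiv n a)).eval (z i).1) (fun a i => (P (pairEquiv n a)).eval (z i).2),
    ← det_pairMatrix_eq_vandermonde P hP, Fintype.prod_prod_type]
  simp only [Fin.prod_univ_two, h0, h1, Finset.prod_mul_distrib]
  ring

theorem pfSum_const_mul {κ : Type*} [Fintype κ] [DecidableEq κ] (c : ℝ)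
    (M : κ × Fin 2 → κ × Fin 2 → ℝ) :
    pfSum (fun a b => c * M a b) = c ^ Fintype.card κ * pfSum M := by
  unfold pfSum
  rw [Finset.mul_sum]
  refine Finset.sum_congr rfl fun σ _ => ?_
  rw [Finset.prod_mul_distrib, Finset.prod_const, Finset.card_univ]
  ring

/-- De Bruijn's formula for `β = 1` and an even number of variables. -/
theorem eigIntegral_one (n : ℕ) (D : Set ℝ) (P : ℕ → ℝ[X]) (hP : IsMonicFamily P) :
    eigIntegral 1 (2 * n) D = 2 ^ n * (2 * n).factorial *
      pfaffian (Matrix.of fun j k : Fin (2 * n) => skew1 D (P j) (P k)) := by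
  have hfac : (n.factorial : ℝ) ≠ 0 := by positivity
  set ν := volume.restrict D
  let F : (Fin (2 * n) → ℝ) → ℝ := fun l =>
    (∏ j, Real.exp (-l j ^ 2 / 2)) * (Matrix.vandermonde l).det
  let S : Equiv.Perm (Fin n × Fin 2) → (Fin (2 * n) → ℝ) → ℝ := fun τ l =>
    ∏ i, Real.sign (l (pairEquiv n (τ (i, 1))) - l (pairEquiv n (τ (i, 0))))
  have hFS : ∀ τ, Integrable (fun l => F l * S τ l) (Measure.pi fun _ => ν) := by
    intro τ
    refine (integrable_weight_mul_vandermonde (2 * n) ν Measure.restrict_le_self).mul_bdd (c := 1)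
      (Finset.measurable_prod _ fun i _ => measurable_sign.comp
        ((measurable_pi_apply (pairEquiv n (τ (i, 1)))).sub
          (measurable_pi_apply (pairEquiv n (τ (i, 0)))))).aestronglyMeasurable
      (Filter.Eventually.of_forall fun l => ?_)
    rw [norm_prod]
    exact Finset.prod_le_one (fun _ _ => norm_nonneg _) fun _ _ => abs_sign_le_one _
  -- Relabelling the variables by τ multiplies the Vandermonde determinant by sgn τ, which cancels
  -- the prefactor; all (2n)! terms are equal.
  have hterm : ∀ τ : Equiv.Perm (Fin n × Fin 2), ((Equiv.Perm.sign τ : ℤ) : ℝ) *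
      ∫ l, F l * S τ l ∂(Measure.pi fun _ => ν) =
      2 ^ n * pfSum fun a b : Fin n × Fin 2 =>
        skew1 D (P (pairEquiv n a)) (P (pairEquiv n b)) := by
    intro τ
    have h := integral_vandermonde_mul_sign n D P hP
    rw [pfSum_const_mul 2 fun a b : Fin n × Fin 2 =>
        skew1 D (P (pairEquiv n a)) (P (pairEquiv n b)), Fintype.card_fin] at h
    rw [← h, ← integral_pi_comp_equiv ν (τ.trans (pairEquiv n)), ← integral_const_mul]
    congr 1
    funext l
    have hv : (Matrix.vandermonde ((l ∘ τ.trans (pairEquiv n)) ∘ (pairEquiv n).symm)).det =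
        ((Equiv.Perm.sign τ : ℤ) : ℝ) * (Matrix.vandermonde l).det := by
      rw [← Equiv.Perm.sign_permCongr (pairEquiv n), ← Matrix.det_permute]
      rfl
    have hw : ∏ c, Real.exp (-(l ∘ τ.trans (pairEquiv n)) c ^ 2 / 2) =
        ∏ j, Real.exp (-l j ^ 2 / 2) :=
      (τ.trans (pairEquiv n)).prod_comp fun j => Real.exp (-l j ^ 2 / 2)
    rw [hv, hw]
    simp only [F, S, Function.comp_apply, Equiv.trans_apply]
    ring
  have hmain : eigIntegral 1 (2 * n) D * (2 ^ n * n.factorial) =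
      (2 * n).factorial * (2 ^ n * pfSum fun a b : Fin n × Fin 2 =>
        skew1 D (P (pairEquiv n a)) (P (pairEquiv n b))) := by
    unfold eigIntegral
    rw [volume_pi, Measure.restrict_pi_pi, ← integral_mul_const]
    have hpt : ∀ l : Fin (2 * n) → ℝ, eigWeight 1 (2 * n) l * (2 ^ n * n.factorial) =
        ∑ τ : Equiv.Perm (Fin n × Fin 2), ((Equiv.Perm.sign τ : ℤ) : ℝ) * (F l * S τ l) := by
      intro l
      rw [eigWeight_one, mul_assoc, abs_vandermonde_mul, ← mul_assoc]
      unfold pfSum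
      rw [Finset.mul_sum]
      refine Finset.sum_congr rfl fun τ _ => ?_
      simp only [F, S]
      ring
    simp_rw [hpt]
    rw [integral_finsetSum _ fun τ _ => (hFS τ).const_mul _]
    simp_rw [integral_const_mul, hterm]
    rw [Finset.sum_const, Finset.card_univ, Fintype.card_perm, nsmul_eq_mul,
      Fintype.card_congr (pairEquiv n), Fintype.card_fin]
  rw [pfaffian_eq_pfSum]
  simp only [Matrix.of_apply]
  have h2 : (2 : ℝ) ^ n ≠ 0 := by positivity
  field_simp
  refine mul_left_cancel₀ h2 ?_
  linear_combination hmain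

/-! ### The distribution function as a ratio of integrals -/

theorem eigWeight_nonneg (β N : ℕ) (l : Fin N → ℝ) : 0 ≤ eigWeight β N l := by
  unfold eigWeight
  positivity

theorem eigIntegral_univ (β N : ℕ) : eigIntegral β N Set.univ = partitionZ β N := by
  simp [eigIntegral, partitionZ]

theorem eigIntegral_pos {β N : ℕ} (hint : Integrable (eigWeight β N)) {D : Set ℝ} {y : ℝ}
    (hD : Set.Iio y ⊆ D) : 0 < eigIntegral β N D := by
  unfold eigIntegral
  rw [setIntegral_pos_iff_support_of_nonneg_ae
    (Filter.Eventually.of_forall fun l => eigWeight_nonneg β N l) hint.integrableOn]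
  -- On this open set of increasing points below y no difference vanishes, so the density is
  -- positive.
  let O : Set (Fin N → ℝ) := {l | (∀ i, l i < y) ∧ ∀ i j, i < j → l i < l j}
  have hO : IsOpen O := by
    have h1 : IsOpen {l : Fin N → ℝ | ∀ i, l i < y} := by
      simp only [Set.ofPred_forall]
      exact isOpen_iInter_of_finite fun i => isOpen_lt (continuous_apply i) continuous_const
    have h2 : IsOpen {l : Fin N → ℝ | ∀ i j, i < j → l i < l j} := by
      simp only [Set.ofPred_forall]
      exact isOpen_iInter_of_finite fun i => isOpen_iInter_of_finite fun j =>
        isOpen_iInter_of_finite fun _ => isOpen_lt (continuous_apply i) (continuous_apply j)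
    exact h1.inter h2
  have hne : O.Nonempty := by
    refine ⟨fun i => y - N + i, fun i => ?_, fun i j hij => ?_⟩
    · have : (i : ℝ) < N := by exact_mod_cast i.isLt
      linarith
    · have : (i : ℝ) < j := by exact_mod_cast hij
      linarith
  refine (hO.measure_pos volume hne).trans_le (measure_mono fun l hl => ⟨?_, fun i _ => hD (hl.1 i)⟩)
  refine (mul_pos (Finset.prod_pos fun j _ => Real.exp_pos _) (Finset.prod_pos fun j _ =>
    Finset.prod_pos fun k hk => pow_pos (abs_pos.mpr ?_) _)).ne'
  exact (sub_pos.mpr (hl.2 j k (Finset.mem_Ioi.mp hk))).ne'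

theorem largestCDF_eq {β N : ℕ} (hint : Integrable (eigWeight β N)) (y : ℝ) :
    largestCDF β N y = eigIntegral β N (Set.Iic y) / eigIntegral β N Set.univ := by
  have hS : {l : Fin N → ℝ | ∀ i, l i < y} = Set.univ.pi fun _ => Set.Iio y := by
    ext l
    simp
  have hZ : 0 ≤ partitionZ β N := integral_nonneg fun l => eigWeight_nonneg β N l
  have hnn : ∀ l, 0 ≤ eigWeight β N l / partitionZ β N :=
    fun l => div_nonneg (eigWeight_nonneg β N l) hZ
  rw [largestCDF, eigLaw, measureReal_def, hS,
    withDensity_apply _ (MeasurableSet.univ_pi fun _ => measurableSet_Iio),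
    ← ofReal_integral_eq_lintegral_ofReal (hint.div_const _).integrableOn
      (Filter.Eventually.of_forall hnn),
    ENNReal.toReal_ofReal (integral_nonneg hnn), integral_div, eigIntegral_univ, eigIntegral,
    volume_pi, Measure.restrict_pi_pi, Measure.restrict_pi_pi]
  simp_rw [Measure.restrict_congr_set Iio_ae_eq_Iic]

/-! ### Monic families orthogonal for a bilinear form -/

theorem IsMonicFamily.coeff_self {P : ℕ → ℝ[X]} (hP : IsMonicFamily P) (j : ℕ) :
    (P j).coeff j = 1 := by
  have := (hP j).1.coeff_natDegree
  rwa [(hP j).2] at this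

theorem IsMonicFamily.sub_mem_degreeLT {P : ℕ → ℝ[X]} (hP : IsMonicFamily P) {n : ℕ} {r : ℝ[X]}
    (hr : r ∈ degreeLT ℝ (n + 1)) : r - C (r.coeff n) * P n ∈ degreeLT ℝ n := by
  rw [mem_degreeLT, degree_lt_iff_coeff_zero] at hr ⊢
  intro m hm
  rw [coeff_sub, coeff_C_mul]
  rcases hm.eq_or_lt with rfl | h
  · rw [hP.coeff_self]
    ring
  · have : (P n).coeff m = 0 := coeff_eq_zero_of_natDegree_lt (by rw [(hP n).2]; exact h)
    rw [hr m h, this]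
    ring

theorem IsMonicFamily.mem_degreeLT {P : ℕ → ℝ[X]} (hP : IsMonicFamily P) {m n : ℕ} (h : m < n) :
    P m ∈ degreeLT ℝ n := by
  rw [Polynomial.mem_degreeLT, degree_eq_natDegree (hP m).1.ne_zero, (hP m).2]
  exact_mod_cast h

theorem IsMonicFamily.map_eq_zero {P : ℕ → ℝ[X]} (hP : IsMonicFamily P) (L : ℝ[X] →ₗ[ℝ] ℝ)
    (n : ℕ) (h : ∀ j < n, L (P j) = 0) (r : ℝ[X]) (hr : r ∈ degreeLT ℝ n) : L r = 0 := by
  induction n generalizing r with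
  | zero =>
    have : r = 0 := by simpa [Polynomial.mem_degreeLT] using hr
    simp [this]
  | succ n ih =>
    have h1 := ih (fun j hj => h j (hj.trans n.lt_succ_self)) _ (hP.sub_mem_degreeLT hr)
    rw [map_sub, ← smul_eq_C_mul, map_smul, h n n.lt_succ_self, smul_zero, sub_zero] at h1
    exact h1

/-- A nondegenerate form on a finite-dimensional space represents every functional, in particular
-B(g, ·). The orthogonal and the skew-orthogonal construction both rest on this. -/
theorem exists_add_orthogonal (B : LinearMap.BilinForm ℝ ℝ[X]) (n : ℕ)
    (hB : ∀ q ∈ degreeLT ℝ n, (∀ r ∈ degreeLT ℝ n, B q r = 0) → q = 0) (g : ℝ[X]) :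
    ∃ q ∈ degreeLT ℝ n, ∀ r ∈ degreeLT ℝ n, B (g + q) r = 0 := by
  have : Module.Finite ℝ (degreeLT ℝ n) := Module.Finite.equiv (degreeLTEquiv ℝ n).symm
  let T : degreeLT ℝ n →ₗ[ℝ] Module.Dual ℝ (degreeLT ℝ n) :=
    B.domRestrict₁₂ (degreeLT ℝ n) (degreeLT ℝ n)
  have hinj : Function.Injective T := by
    rw [injective_iff_map_eq_zero]
    intro q hq
    refine Subtype.ext (hB q q.2 fun r hr => ?_)
    exact congrArg (fun L : Module.Dual ℝ (degreeLT ℝ n) => L ⟨r, hr⟩) hq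
  have hsurj : Function.Surjective T :=
    (LinearMap.injective_iff_surjective_of_finrank_eq_finrank
      Subspace.dual_finrank_eq.symm).mp hinj
  obtain ⟨q, hq⟩ := hsurj (-((B g).domRestrict (degreeLT ℝ n)))
  refine ⟨q, q.2, fun r hr => ?_⟩
  have h := congrArg (fun L : Module.Dual ℝ (degreeLT ℝ n) => L ⟨r, hr⟩) hq
  have h' : B q r = -B g r := h
  rw [map_add, LinearMap.add_apply, h']
  ring

theorem monic_X_pow_add_of_mem {m j : ℕ} (hm : m ≤ j) {q : ℝ[X]} (hq : q ∈ degreeLT ℝ m) :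
    (X ^ j + q).Monic ∧ (X ^ j + q).natDegree = j := by
  have hd : q.degree < j := (Polynomial.mem_degreeLT.mp hq).trans_le (by exact_mod_cast hm)
  refine ⟨monic_X_pow_add hd, natDegree_eq_of_degree_eq_some ?_⟩
  rw [degree_add_eq_left_of_degree_lt (by rwa [degree_X_pow]), degree_X_pow]

theorem exists_isOrthogonalFamily (B : LinearMap.BilinForm ℝ ℝ[X])
    (hsymm : ∀ f g, B f g = B g f) (hB : ∀ q, B q q = 0 → q = 0) :
    ∃ p, IsOrthogonalFamily (fun f g => B f g) p := by
  choose q hq horth using fun j => exists_add_orthogonal B j (fun q hq h => hB q (h q hq)) (X ^ j)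
  have hmon : IsMonicFamily fun j => X ^ j + q j := fun j => monic_X_pow_add_of_mem le_rfl (hq j)
  refine ⟨_, hmon, fun j k hjk => ?_⟩
  rcases lt_or_gt_of_ne hjk with h | h
  · exact (hsymm _ _).trans (horth k _ (hmon.mem_degreeLT h))
  · exact horth j _ (hmon.mem_degreeLT h)

theorem IsOrthogonalFamily.eq_zero_of_mem {B : LinearMap.BilinForm ℝ ℝ[X]} {p : ℕ → ℝ[X]}
    (hp : IsOrthogonalFamily (fun f g => B f g) p) {j : ℕ} {r : ℝ[X]} (hr : r ∈ degreeLT ℝ j) :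
    B (p j) r = 0 :=
  hp.1.map_eq_zero (B (p j)) j (fun k hk => hp.2 j k hk.ne') r hr

theorem IsOrthogonalFamily.unique {B : LinearMap.BilinForm ℝ ℝ[X]} (hB : ∀ q, B q q = 0 → q = 0)
    {p p' : ℕ → ℝ[X]} (hp : IsOrthogonalFamily (fun f g => B f g) p)
    (hp' : IsOrthogonalFamily (fun f g => B f g) p') : p = p' := by
  funext j
  have hd : p j - p' j ∈ degreeLT ℝ j := by
    have h1 := hp'.1.sub_mem_degreeLT (hp.1.mem_degreeLT j.lt_succ_self)
    rwa [hp.1.coeff_self, C_1, one_mul] at h1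
  refine sub_eq_zero.mp (hB _ ?_)
  rw [map_sub (B : ℝ[X] →ₗ[ℝ] ℝ[X] →ₗ[ℝ] ℝ), LinearMap.sub_apply, hp.eq_zero_of_mem hd,
    hp'.eq_zero_of_mem hd, sub_zero]

theorem pfaffian_eq_zero {n : ℕ} (M : Matrix (Fin (2 * n)) (Fin (2 * n)) ℝ) (m : Fin (2 * n))
    (hr : ∀ k, M m k = 0) (hc : ∀ k, M k m = 0) : pfaffian M = 0 := by
  rw [pfaffian_eq_pfSum, pfSum, Finset.sum_eq_zero, mul_zero]
  intro σ _
  obtain ⟨⟨i, b⟩, hc'⟩ := (σ.trans (pairEquiv n)).surjective m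
  rw [Finset.prod_eq_zero (Finset.mem_univ i), mul_zero]
  fin_cases b
  · have : pairEquiv n (σ (i, 0)) = m := hc'
    rw [this, hr]
  · have : pairEquiv n (σ (i, 1)) = m := hc'
    rw [this, hc]

theorem exists_isSkewOrthogonalFamily (B : LinearMap.BilinForm ℝ ℝ[X])
    (hskew : ∀ f g, B f g = -B g f)
    (hpf : ∀ P, IsMonicFamily P → ∀ n : ℕ,
      pfaffian (Matrix.of fun j k : Fin (2 * n) => B (P j) (P k)) ≠ 0) :
    ∃ R, IsSkewOrthogonalFamily (fun f g => B f g) R := by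
  have hself : ∀ f, B f f = 0 := fun f => by linarith [hskew f f]
  have hnd : ∀ n : ℕ, ∀ q ∈ degreeLT ℝ (2 * n),
      (∀ r ∈ degreeLT ℝ (2 * n), B q r = 0) → q = 0 := by
    intro n q hq h
    by_contra hne
    -- A nonzero q in the radical, made monic, can be a member of a monic family; the Gram matrix
    -- then has a zero row and column.
    let P : ℕ → ℝ[X] := fun j => if j = q.natDegree then q * C q.leadingCoeff⁻¹ else X ^ j
    have hP : IsMonicFamily P := by
      intro j
      by_cases hj : j = q.natDegree
      · simp only [P, hj, if_true]
        exact ⟨monic_mul_leadingCoeff_inv hne, natDegree_mul_leadingCoeff_inv q hne⟩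
      · simp only [P, hj, if_false]
        exact isMonicFamily_X_pow j
    have hlt : q.natDegree < 2 * n := (natDegree_lt_iff_degree_lt hne).mpr
      (Polynomial.mem_degreeLT.mp hq)
    have hrow : ∀ k : Fin (2 * n), B (P q.natDegree) (P k) = 0 := by
      intro k
      have : P q.natDegree = q.leadingCoeff⁻¹ • q := by
        simp only [P, if_true]
        rw [smul_eq_C_mul, mul_comm]
      rw [this, map_smul, LinearMap.smul_apply, h _ (hP.mem_degreeLT k.isLt), smul_zero]
    refine hpf P hP n (pfaffian_eq_zero _ ⟨q.natDegree, hlt⟩ hrow fun k => ?_)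
    have := hrow k
    rw [Matrix.of_apply, hskew, this, neg_zero]
  -- Degrees 2i and 2i + 1 are both corrected only against degrees below 2i. Within a pair nothing
  -- is imposed: the cross product is the normalization.
  choose q hq horth using fun j => exists_add_orthogonal B (2 * (j / 2)) (hnd (j / 2)) (X ^ j)
  have hmon : IsMonicFamily fun j => X ^ j + q j :=
    fun j => monic_X_pow_add_of_mem (by omega) (hq j)
  set R : ℕ → ℝ[X] := fun j => X ^ j + q j
  have hlow : ∀ j k, j / 2 ≠ k / 2 → B (R j) (R k) = 0 := by
    intro j k hjk
    rcases lt_or_gt_of_ne hjk with h | h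
    · rw [hskew, neg_eq_zero]
      exact horth k _ (hmon.mem_degreeLT (by omega))
    · exact horth j _ (hmon.mem_degreeLT (by omega))
  have h01 : ∀ j k, B (R (2 * j)) (R (2 * k + 1)) =
      if j = k then skewNorm (fun f g => B f g) R j else 0 := by
    intro j k
    split_ifs with h
    · rw [h]; rfl
    · exact hlow _ _ (by omega)
  refine ⟨R, hmon, fun j k => ⟨?_, ?_, h01 j k, ?_⟩⟩
  · by_cases h : j = k
    · rw [h]; exact hself _
    · exact hlow _ _ (by omega)
  · by_cases h : j = k
    · rw [h]; exact hself _
    · exact hlow _ _ (by omega)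
  · simp only
    rw [hskew, h01]

/-- The Pfaffian of the Gram matrix of a skew-orthogonal family. -/
theorem pfaffian_skewOrthogonal {B : ℝ[X] → ℝ[X] → ℝ} {R : ℕ → ℝ[X]}
    (hR : IsSkewOrthogonalFamily B R) (n : ℕ) :
    pfaffian (Matrix.of fun j k : Fin (2 * n) => B (R j) (R k)) =
      ∏ j ∈ Finset.range n, skewNorm B R j := by
  rw [pfaffian_eq_det _ (Matrix.diagonal fun i : Fin n => skewNorm B R i), Matrix.det_diagonal,
    Finset.prod_range]
  · intro i j
    simpa [pairEquiv_val] using (hR.2 i j).1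
  · intro i j
    simpa [pairEquiv_val] using (hR.2 i j).2.1
  · intro i j
    simpa [pairEquiv_val, Matrix.diagonal_apply, Fin.ext_iff] using (hR.2 i j).2.2.1
  · intro i j
    simpa [pairEquiv_val, Matrix.diagonal_apply, Fin.ext_iff] using (hR.2 i j).2.2.2

/-! ### The bilinear forms -/

/-- The bilinear form `ip2 D`. -/
def ip2Form (D : Set ℝ) : LinearMap.BilinForm ℝ ℝ[X] :=
  LinearMap.mk₂ ℝ (ip2 D)
    (fun f f' g => by
      simp only [ip2]
      rw [← integral_add]
      · congr 1; funext x; simp; ring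
      all_goals simpa using (integrable_mul_gauss one_pos _ _).restrict)
    (fun c f g => by
      simp only [ip2, smul_eq_mul]
      rw [← integral_const_mul]
      congr 1; funext x; simp; ring)
    (fun f g g' => by
      simp only [ip2]
      rw [← integral_add]
      · congr 1; funext x; simp; ring
      all_goals simpa using (integrable_mul_gauss one_pos _ _).restrict)
    (fun c f g => by
      simp only [ip2, smul_eq_mul]
      rw [← integral_const_mul]
      congr 1; funext x; simp; ring)

theorem ip2_comm (D : Set ℝ) (f g : ℝ[X]) : ip2 D f g = ip2 D g f := by
  simp only [ip2]
  congr 1; funext x; ring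

theorem ip2_self_pos {D : Set ℝ} {y : ℝ} (hD : Set.Iio y ⊆ D) {q : ℝ[X]} (hq : q ≠ 0) :
    0 < ip2 D q q := by
  have hint : IntegrableOn (fun x => Real.exp (-x ^ 2) * q.eval x * q.eval x) D := by
    simpa using (integrable_mul_gauss one_pos q q).integrableOn
  unfold ip2
  rw [setIntegral_pos_iff_support_of_nonneg_ae (Filter.Eventually.of_forall fun x => by
    simp only [Pi.zero_apply, mul_assoc]
    exact mul_nonneg (Real.exp_pos _).le (mul_self_nonneg _)) hint]
  have hsub : Set.Iio y \ (q.roots.toFinset : Set ℝ) ⊆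
      (Function.support fun x => Real.exp (-x ^ 2) * q.eval x * q.eval x) ∩ D := by
    rintro x ⟨hx, hr⟩
    have hx0 : q.eval x ≠ 0 := fun h => hr (by simp [hq, h])
    exact ⟨mul_ne_zero (mul_ne_zero (Real.exp_pos _).ne' hx0) hx0, hD hx⟩
  refine lt_of_lt_of_le ?_ (measure_mono hsub)
  rw [measure_sdiff_null (Finset.measure_zero _ _)]
  simp

theorem ip2Form_self_eq_zero {D : Set ℝ} {y : ℝ} (hD : Set.Iio y ⊆ D) (q : ℝ[X])
    (h : ip2Form D q q = 0) : q = 0 := by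
  by_contra hne
  exact (ip2_self_pos hD hne).ne' h

/-- The common form of `skew4` (`b = 2`) and `skew4Mod` (`b = 1`). -/
def gaussSkew (b : ℝ) (D : Set ℝ) (f g : ℝ[X]) : ℝ :=
  (1 / 2) * ∫ x in D, Real.exp (-b * x ^ 2) *
    (f.eval x * g.derivative.eval x - g.eval x * f.derivative.eval x)

theorem gaussSkew_one (D : Set ℝ) : gaussSkew 1 D = skew4Mod D := by
  funext f g
  simp [gaussSkew, skew4Mod]

theorem gaussSkew_swap (b : ℝ) (D : Set ℝ) (f g : ℝ[X]) :
    gaussSkew b D f g = -gaussSkew b D g f := by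
  unfold gaussSkew
  rw [← mul_neg, ← integral_neg]
  congr 2; funext x; ring

theorem integrable_gaussSkew {b : ℝ} (hb : 0 < b) (D : Set ℝ) (f g : ℝ[X]) :
    Integrable (fun x => Real.exp (-b * x ^ 2) *
    (f.eval x * g.derivative.eval x - g.eval x * f.derivative.eval x)) (volume.restrict D) := by
  simpa using (integrable_gauss_poly hb (f * g.derivative - g * f.derivative)).restrict

/-- The bilinear form `gaussSkew b D`. -/
def gaussSkewForm {b : ℝ} (hb : 0 < b) (D : Set ℝ) : LinearMap.BilinForm ℝ ℝ[X] :=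
  have add_right : ∀ f g g' : ℝ[X], gaussSkew b D f (g + g') =
      gaussSkew b D f g + gaussSkew b D f g' := fun f g g' => by
    unfold gaussSkew
    rw [← mul_add, ← integral_add (integrable_gaussSkew hb D f g) (integrable_gaussSkew hb D f g')]
    congr 2; funext x; simp; ring
  have smul_right : ∀ (c : ℝ) (f g : ℝ[X]), gaussSkew b D f (c • g) =
      c • gaussSkew b D f g := fun c f g => by
    unfold gaussSkew
    rw [smul_eq_mul, mul_left_comm, ← integral_const_mul c]
    congr 2; funext x; simp; ring
  LinearMap.mk₂ ℝ (gaussSkew b D)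
    (fun f f' g => by
      rw [gaussSkew_swap, add_right, gaussSkew_swap _ _ f, gaussSkew_swap _ _ f']; ring)
    (fun c f g => by rw [gaussSkew_swap, smul_right, gaussSkew_swap _ _ f, smul_neg])
    add_right smul_right

/-- The bilinear form `skew1 D`. -/
def skew1Form (D : Set ℝ) : LinearMap.BilinForm ℝ ℝ[X] :=
  have add_right : ∀ f g g' : ℝ[X], skew1 D f (g + g') = skew1 D f g + skew1 D f g' :=
    fun f g g' => by
    simp only [skew1_eq_integral_prod]
    rw [← mul_add, ← integral_add (skew1_integrable D f g) (skew1_integrable D f g')]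
    congr 2; funext x; simp; ring
  have smul_right : ∀ (c : ℝ) (f g : ℝ[X]), skew1 D f (c • g) = c • skew1 D f g :=
    fun c f g => by
    simp only [skew1_eq_integral_prod]
    rw [smul_eq_mul, mul_left_comm, ← integral_const_mul c]
    congr 2; funext x; simp; ring
  LinearMap.mk₂ ℝ (skew1 D)
    (fun f f' g => by
      rw [skew1_swap, add_right, skew1_swap _ f, skew1_swap _ f']; ring)
    (fun c f g => by rw [skew1_swap, smul_right, skew1_swap _ f, smul_neg])
    add_right smul_right

/-! ### Existence of the families for the concrete forms. -/

theorem exists_isSkewOrthogonalFamily_skew1 {D : Set ℝ} {y : ℝ} (hD : Set.Iio y ⊆ D) :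
    ∃ R, IsSkewOrthogonalFamily (skew1 D) R :=
  exists_isSkewOrthogonalFamily (skew1Form D) (skew1_swap D) fun P hP n h0 => by
    have h := eigIntegral_pos (integrable_eigWeight_one (2 * n)) hD
    rw [eigIntegral_one n D P hP] at h
    exact h.ne' (mul_eq_zero_of_right _ h0)

theorem exists_isSkewOrthogonalFamily_skew4 {D : Set ℝ} {y : ℝ} (hD : Set.Iio y ⊆ D) :
    ∃ R, IsSkewOrthogonalFamily (skew4 D) R :=
  exists_isSkewOrthogonalFamily (gaussSkewForm two_pos D) (gaussSkew_swap 2 D)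
    fun P hP n h0 => by
    have h := eigIntegral_pos (integrable_eigWeight_four n) hD
    rw [eigIntegral_four n D P hP] at h
    exact h.ne' (mul_eq_zero_of_right _ h0)

theorem exists_isOrthogonalFamily_ip2 {D : Set ℝ} {y : ℝ} (hD : Set.Iio y ⊆ D) :
    ∃ p, IsOrthogonalFamily (ip2 D) p :=
  exists_isOrthogonalFamily (ip2Form D) (ip2_comm D) (ip2Form_self_eq_zero hD)

open scoped Pointwise

/-! ### Integration by parts against a Gaussian weight -/

theorem hasDerivAt_gauss_mul_poly (b : ℝ) (q : ℝ[X]) (x : ℝ) :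
    HasDerivAt (fun x => Real.exp (-b * x ^ 2) * q.eval x)
      (Real.exp (-b * x ^ 2) * (q.derivative - C (2 * b) * X * q).eval x) x := by
  have h1 : HasDerivAt (fun x : ℝ => -b * x ^ 2) (-b * (2 * x)) x := by
    simpa using (hasDerivAt_pow 2 x).const_mul (-b)
  refine (h1.exp.mul (q.hasDerivAt x)).congr_deriv ?_
  simp
  ring

theorem integral_Iic_gauss_deriv {b : ℝ} (hb : 0 < b) (y : ℝ) (q : ℝ[X]) :
    ∫ x in Set.Iic y, Real.exp (-b * x ^ 2) * (q.derivative - C (2 * b) * X * q).eval x =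
      Real.exp (-b * y ^ 2) * q.eval y := by
  have hd := hasDerivAt_gauss_mul_poly b q
  have hi := (integrable_gauss_poly hb (q.derivative - C (2 * b) * X * q)).integrableOn
    (s := Set.Iic y)
  rw [integral_Iic_of_hasDerivAt_of_tendsto' (fun x _ => hd x) hi
    (tendsto_zero_of_hasDerivAt_of_integrableOn_Iic (fun x _ => hd x) hi
      (integrable_gauss_poly hb q).integrableOn), sub_zero]

theorem integral_gauss_deriv {b : ℝ} (hb : 0 < b) (q : ℝ[X]) :
    ∫ x, Real.exp (-b * x ^ 2) * (q.derivative - C (2 * b) * X * q).eval x = 0 :=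
  integral_eq_zero_of_hasDerivAt_of_integrable (hasDerivAt_gauss_mul_poly b q)
    (integrable_gauss_poly hb _) (integrable_gauss_poly hb q)

/-! ### Gram matrices for `β = 4` -/

/-- Half of (e^{-x²} f g)' is split off. If f has lower degree than g and g is orthogonal to all
lower degrees, then f' drops out and x f contributes only through its top coefficient. -/
theorem skew4Mod_eq (D : Set ℝ) (f g : ℝ[X]) :
    skew4Mod D f g = (1 / 2) * (∫ x in D, Real.exp (-1 * x ^ 2) *
      ((f * g).derivative - C (2 * 1) * X * (f * g)).eval x) +
      ip2 D (X * f) g - ip2 D f.derivative g := by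
  have h1 : Integrable (fun x => Real.exp (-x ^ 2) * (X * f).eval x * g.eval x)
      (volume.restrict D) := by
    simpa only [neg_mul, one_mul] using (integrable_mul_gauss one_pos (X * f) g).restrict
  have h2 : Integrable (fun x => Real.exp (-x ^ 2) * f.derivative.eval x * g.eval x)
      (volume.restrict D) := by
    simpa only [neg_mul, one_mul] using (integrable_mul_gauss one_pos f.derivative g).restrict
  have h3 := (integrable_gauss_poly one_pos
    ((f * g).derivative - C (2 * 1) * X * (f * g))).restrict (s := D)
  have h4 : Integrable (fun x => 1 / 2 * (Real.exp (-1 * x ^ 2) *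
      ((f * g).derivative - C (2 * 1) * X * (f * g)).eval x) +
      Real.exp (-x ^ 2) * (X * f).eval x * g.eval x) (volume.restrict D) :=
    (h3.const_mul _).add h1
  rw [skew4Mod, ip2, ip2, ← integral_const_mul, ← integral_const_mul,
    ← integral_add (h3.const_mul _) h1, ← integral_sub h4 h2]
  congr 1
  funext x
  simp
  ring

theorem IsMonicFamily.derivative_mem {P : ℕ → ℝ[X]} (hP : IsMonicFamily P) (j : ℕ) :
    (P j).derivative ∈ degreeLT ℝ j := by
  rw [Polynomial.mem_degreeLT]
  have := degree_derivative_lt (hP j).1.ne_zero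
  rwa [degree_eq_natDegree (hP j).1.ne_zero, (hP j).2] at this

theorem IsMonicFamily.X_mul_mem {P : ℕ → ℝ[X]} (hP : IsMonicFamily P) (j : ℕ) :
    X * P j ∈ degreeLT ℝ (j + 2) := by
  rw [Polynomial.mem_degreeLT, degree_mul, degree_X, degree_eq_natDegree (hP j).1.ne_zero,
    (hP j).2]
  norm_cast
  omega

theorem degreeLT_le {m n : ℕ} (h : m ≤ n) {q : ℝ[X]} (hq : q ∈ degreeLT ℝ m) :
    q ∈ degreeLT ℝ n := degreeLT_mono h hq

section Orthogonal

variable {D : Set ℝ} {p : ℕ → ℝ[X]}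

theorem ip2_eq_zero_of_mem (hp : IsOrthogonalFamily (ip2 D) p) {j : ℕ} {r : ℝ[X]}
    (hr : r ∈ degreeLT ℝ j) : ip2 D (p j) r = 0 :=
  IsOrthogonalFamily.eq_zero_of_mem (B := ip2Form D) hp hr

theorem ip2_eq_coeff_mul (hp : IsOrthogonalFamily (ip2 D) p) {j : ℕ} {r : ℝ[X]}
    (hr : r ∈ degreeLT ℝ (j + 1)) : ip2 D (p j) r = r.coeff j * ip2 D (p j) (p j) := by
  have h := ip2_eq_zero_of_mem hp (hp.1.sub_mem_degreeLT hr)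
  have h2 : ip2 D (p j) (r - C (r.coeff j) * p j) =
      ip2 D (p j) r - r.coeff j * ip2 D (p j) (p j) := by
    have := map_sub (ip2Form D (p j)) r (r.coeff j • p j)
    rw [map_smul, smul_eq_C_mul] at this
    exact this
  linarith

theorem skew4Mod_orthogonal (hp : IsOrthogonalFamily (ip2 D) p) {j k : ℕ} (hjk : j < k) :
    skew4Mod D (p j) (p k) = (1 / 2) * (∫ x in D, Real.exp (-1 * x ^ 2) *
      ((p j * p k).derivative - C (2 * 1) * X * (p j * p k)).eval x) +
      if j + 1 = k then ip2 D (p k) (p k) else 0 := by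
  rw [skew4Mod_eq, ip2_comm D (derivative _), ip2_comm D (X * _),
    ip2_eq_zero_of_mem hp (degreeLT_le hjk.le (hp.1.derivative_mem j)), sub_zero]
  congr 1
  split_ifs with h
  · subst h
    rw [ip2_eq_coeff_mul hp (hp.1.X_mul_mem j), coeff_X_mul, hp.1.coeff_self, one_mul]
  · exact ip2_eq_zero_of_mem hp (degreeLT_le (by omega) (hp.1.X_mul_mem j))

end Orthogonal

theorem skewMatrix_eq_of {B : ℝ[X] → ℝ[X] → ℝ} (hB : ∀ f g, B f g = -B g f) {p : ℕ → ℝ[X]}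
    {v : ℕ → ℕ → ℝ} (hv : ∀ j k, j < k → B (p j) (p k) = v j k) (m : ℕ) :
    skewMatrix v m = Matrix.of fun j k : Fin m => B (p j) (p k) := by
  ext j k
  simp only [skewMatrix, Matrix.of_apply]
  split_ifs with h1 h2
  · exact (hv j k h1).symm
  · rw [hB, hv k j h2]
  · have : j = k := le_antisymm (not_lt.mp h2) (not_lt.mp h1)
    subst this
    linarith [hB (p j) (p j)]

theorem skew4Mod_swap (D : Set ℝ) (f g : ℝ[X]) : skew4Mod D f g = -skew4Mod D g f := by
  rw [← gaussSkew_one]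
  exact gaussSkew_swap 1 D f g

theorem wMatrix_eq {y : ℝ} {p : ℕ → ℝ[X]} (hp : IsNadalMajumdar y p) (m : ℕ) :
    wMatrix y p m = Matrix.of fun j k : Fin m => skew4Mod (Set.Iic y) (p j) (p k) := by
  refine skewMatrix_eq_of (skew4Mod_swap _) (fun j k hjk => ?_) m
  rw [skew4Mod_orthogonal hp hjk, integral_Iic_gauss_deriv one_pos, wEntry, omegaEntry, hNorm,
    eval_mul, neg_one_mul]
  ring

/-! ### The orthogonal polynomials for the full line -/

section Hermite

variable {H : ℕ → ℝ[X]}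

/-- The boundary term vanishes on ℝ, so `skew4Mod_eq` gives h_{j+1} for ⟪H_j, H_{j+1}⟫ and h_{j+1} -
(j+1) h_j for the reversed product. Skew symmetry makes these sum to zero. -/
theorem ip2_hermite_succ (hH : IsOrthogonalFamily (ip2 Set.univ) H) (j : ℕ) :
    ip2 Set.univ (H (j + 1)) (H (j + 1)) = (j + 1) / 2 * ip2 Set.univ (H j) (H j) := by
  have hr : (H (j + 1)).derivative ∈ degreeLT ℝ (j + 1) := hH.1.derivative_mem (j + 1)
  have h1 := skew4Mod_eq Set.univ (H j) (H (j + 1))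
  have h2 := skew4Mod_eq Set.univ (H (j + 1)) (H j)
  have h3 := skew4Mod_swap Set.univ (H j) (H (j + 1))
  rw [setIntegral_univ, integral_gauss_deriv one_pos, ip2_comm _ (X * _),
    ip2_eq_coeff_mul hH (hH.1.X_mul_mem j), ip2_comm _ (derivative _),
    ip2_eq_zero_of_mem hH (degreeLT_le j.le_succ (hH.1.derivative_mem j)), coeff_X_mul,
    hH.1.coeff_self] at h1
  have hX : ip2 Set.univ (X * H (j + 1)) (H j) = ip2 Set.univ (X * H j) (H (j + 1)) := by
    simp only [ip2]
    congr 1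
    funext x
    simp
    ring
  rw [setIntegral_univ, integral_gauss_deriv one_pos, hX, ip2_comm _ (X * _),
    ip2_eq_coeff_mul hH (hH.1.X_mul_mem j), ip2_comm _ (derivative _),
    ip2_eq_coeff_mul hH hr, coeff_X_mul, hH.1.coeff_self, coeff_derivative,
    hH.1.coeff_self] at h2
  linarith

theorem ip2_hermite (hH : IsOrthogonalFamily (ip2 Set.univ) H) (j : ℕ) :
    ip2 Set.univ (H j) (H j) = Real.sqrt Real.pi * j.factorial / 2 ^ j := by
  induction j with
  | zero =>
    have h0 : H 0 = 1 := (hH.1 0).1.natDegree_eq_zero.mp (hH.1 0).2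
    simpa [h0, ip2] using integral_gaussian 1
  | succ j ih =>
    rw [ip2_hermite_succ hH, ih, Nat.factorial_succ, pow_succ]
    push_cast
    field_simp

/-- Only neighbouring indices pair nontrivially, so the even-odd block is lower bidiagonal. -/
theorem pfaffian_skew4Mod_hermite (hH : IsOrthogonalFamily (ip2 Set.univ) H) (N : ℕ) :
    pfaffian (Matrix.of fun j k : Fin (2 * N) => skew4Mod Set.univ (H j) (H k)) =
      ∏ j ∈ Finset.range N, ip2 Set.univ (H (2 * j + 1)) (H (2 * j + 1)) := by
  have hlt : ∀ j k, j < k → skew4Mod Set.univ (H j) (H k) =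
      if j + 1 = k then ip2 Set.univ (H k) (H k) else 0 := by
    intro j k hjk
    rw [skew4Mod_orthogonal hH hjk, setIntegral_univ, integral_gauss_deriv one_pos]
    ring
  have hz : ∀ j k, j + 1 ≠ k → k + 1 ≠ j → skew4Mod Set.univ (H j) (H k) = 0 := by
    intro j k h1 h2
    rcases lt_trichotomy j k with h | h | h
    · rw [hlt j k h, if_neg h1]
    · subst h
      linarith [skew4Mod_swap Set.univ (H j) (H j)]
    · rw [skew4Mod_swap, hlt k j h, if_neg h2, neg_zero]
  rw [pfaffian_eq_det _ (Matrix.of fun i j : Fin N =>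
      skew4Mod Set.univ (H (2 * i)) (H (2 * j + 1))), Matrix.det_of_isLowerTriangular,
    Finset.prod_range]
  · refine Finset.prod_congr rfl fun i _ => ?_
    rw [Matrix.of_apply, hlt _ _ (by omega), if_pos rfl]
  · intro i j hij
    have : (i : ℕ) < j := hij
    exact hz _ _ (by omega) (by omega)
  · intro i j
    simp only [Matrix.of_apply, pairEquiv_val]
    exact hz _ _ (by simp; omega) (by simp; omega)
  · intro i j
    simp only [Matrix.of_apply, pairEquiv_val]
    exact hz _ _ (by simp; omega) (by simp; omega)
  · intro i j
    simp [pairEquiv_val]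
  · intro i j
    simp only [Matrix.of_apply, pairEquiv_val]
    rw [skew4Mod_swap]
    simp

end Hermite

/-! ### Rescaling for `β = 4` -/

/-- The factor √2 from differentiating the composition cancels the Jacobian of u = √2 x. -/
theorem skew4_comp (D : Set ℝ) (f g : ℝ[X]) :
    skew4 D (f.comp (C (Real.sqrt 2) * X)) (g.comp (C (Real.sqrt 2) * X)) =
      skew4Mod (Real.sqrt 2 • D) f g := by
  have hs : (0 : ℝ) < Real.sqrt 2 := by positivity
  have h := Measure.setIntegral_comp_smul_of_pos volume (fun x : ℝ => Real.exp (-x ^ 2) *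
    (f.eval x * g.derivative.eval x - g.eval x * f.derivative.eval x)) D hs
  rw [Module.finrank_self, pow_one, smul_eq_mul, eq_inv_mul_iff_mul_eq₀ hs.ne'] at h
  rw [skew4Mod, ← h, ← integral_const_mul, skew4]
  congr 2
  funext x
  have : (Real.sqrt 2 * x) ^ 2 = 2 * x ^ 2 := by
    rw [mul_pow, Real.sq_sqrt (by norm_num)]
  simp [derivative_comp, this]
  ring

theorem IsMonicFamily.rescale {P : ℕ → ℝ[X]} (hP : IsMonicFamily P) :
    IsMonicFamily fun j => (Real.sqrt 2)⁻¹ ^ j • (P j).comp (C (Real.sqrt 2) * X) := by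
  have hs : Real.sqrt 2 ≠ 0 := by positivity
  have hd : (C (Real.sqrt 2) * X : ℝ[X]).natDegree = 1 := natDegree_C_mul_X _ hs
  intro j
  have hn : ((P j).comp (C (Real.sqrt 2) * X)).natDegree = j := by
    rw [natDegree_comp, hd, mul_one, (hP j).2]
  beta_reduce
  constructor
  · rw [Monic, smul_eq_C_mul, leadingCoeff_mul, leadingCoeff_C, leadingCoeff_comp (by rw [hd]; simp),
      (hP j).1.leadingCoeff, leadingCoeff_mul, leadingCoeff_C, leadingCoeff_X, (hP j).2, one_mul,
      mul_one, ← mul_pow, inv_mul_cancel₀ hs, one_pow]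
  · rw [smul_eq_C_mul, natDegree_C_mul (pow_ne_zero _ (inv_ne_zero hs)), hn]

theorem skew4_rescale (D : Set ℝ) (P : ℕ → ℝ[X]) (j k : ℕ) :
    skew4 D ((Real.sqrt 2)⁻¹ ^ j • (P j).comp (C (Real.sqrt 2) * X))
      ((Real.sqrt 2)⁻¹ ^ k • (P k).comp (C (Real.sqrt 2) * X)) =
    (Real.sqrt 2)⁻¹ ^ j * (Real.sqrt 2)⁻¹ ^ k * skew4Mod (Real.sqrt 2 • D) (P j) (P k) := by
  rw [← skew4_comp]
  have h1 : ∀ (c : ℝ) (f g : ℝ[X]), skew4 D (c • f) g = c * skew4 D f g := fun c f g => by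
    have := LinearMap.map_smul₂ (gaussSkewForm two_pos D) c f g
    exact this
  have h2 : ∀ (c : ℝ) (f g : ℝ[X]), skew4 D f (c • g) = c * skew4 D f g :=
    fun c f g => (gaussSkewForm two_pos D f).map_smul c g
  rw [h1, h2]
  ring

/-- Every index occurs exactly once in each term of the Pfaffian. -/
theorem pfaffian_diagonal_scale {n : ℕ} (d : ℕ → ℝ) (M : ℕ → ℕ → ℝ) :
    pfaffian (Matrix.of fun j k : Fin (2 * n) => d j * d k * M j k) =
      (∏ j ∈ Finset.range (2 * n), d j) *
        pfaffian (Matrix.of fun j k : Fin (2 * n) => M j k) := by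
  rw [pfaffian_eq_pfSum, pfaffian_eq_pfSum, mul_left_comm]
  congr 1
  unfold pfSum
  rw [Finset.mul_sum]
  refine Finset.sum_congr rfl fun σ _ => ?_
  have h : ∏ j ∈ Finset.range (2 * n), d j =
      ∏ i, d (pairEquiv n (σ (i, 0))) * d (pairEquiv n (σ (i, 1))) := by
    rw [Finset.prod_range, ← (σ.trans (pairEquiv n)).prod_comp, Fintype.prod_prod_type]
    simp [Fin.prod_univ_two]
  rw [h]
  simp only [Matrix.of_apply, Finset.prod_mul_distrib]
  ring

theorem eigIntegral_four_rescaled (N : ℕ) (D : Set ℝ) (P : ℕ → ℝ[X]) (hP : IsMonicFamily P) :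
    eigIntegral 4 N D = 2 ^ N * N.factorial *
      ((∏ j ∈ Finset.range (2 * N), (Real.sqrt 2)⁻¹ ^ j) *
        pfaffian (Matrix.of fun j k : Fin (2 * N) =>
          skew4Mod (Real.sqrt 2 • D) (P j) (P k))) := by
  rw [eigIntegral_four N D _ hP.rescale, ← pfaffian_diagonal_scale (fun j => (Real.sqrt 2)⁻¹ ^ j)
    fun j k => skew4Mod (Real.sqrt 2 • D) (P j) (P k)]
  simp only [skew4_rescale]

theorem sqrt_two_smul_Iic (y : ℝ) : Real.sqrt 2 • Set.Iic y = Set.Iic (Real.sqrt 2 * y) :=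
  LinearOrderedField.smul_Iic (by positivity)

theorem exists_isSkewOrthogonalFamily_skew4Mod (y : ℝ) :
    ∃ R, IsSkewOrthogonalFamily (skew4Mod (Set.Iic y)) R := by
  have hs : Real.sqrt 2 ≠ 0 := by positivity
  rw [← gaussSkew_one]
  refine exists_isSkewOrthogonalFamily (gaussSkewForm one_pos (Set.Iic y)) (gaussSkew_swap 1 _)
    fun P hP n h0 => ?_
  -- The endpoint y / √2 is chosen so that rescaling takes it to y.
  have h := eigIntegral_pos (integrable_eigWeight_four n)
    (Set.Iio_subset_Iic_self (a := (Real.sqrt 2)⁻¹ * y))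
  rw [eigIntegral_four_rescaled n _ P hP, sqrt_two_smul_Iic, mul_inv_cancel_left₀ hs,
    ← gaussSkew_one] at h
  exact h.ne' (mul_eq_zero_of_right _ (mul_eq_zero_of_right _ h0))

theorem prod_rescale (N : ℕ) : ∏ j ∈ Finset.range (2 * N), (Real.sqrt 2)⁻¹ ^ j =
    ∏ j ∈ Finset.range N, (2 : ℝ) ^ (-2 * (j : ℝ) - 1 / 2) := by
  induction N with
  | zero => simp
  | succ N ih =>
    rw [show 2 * (N + 1) = 2 * N + 1 + 1 by ring, Finset.prod_range_succ, Finset.prod_range_succ,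
      Finset.prod_range_succ, ih, mul_assoc, ← pow_add]
    congr 1
    rw [Real.sqrt_eq_rpow, ← Real.rpow_neg (by norm_num), ← Real.rpow_natCast,
      ← Real.rpow_mul (by norm_num)]
    congr 1
    push_cast
    ring

/-! ### The distribution function for β = 4. -/

theorem largestCDF_four_skewNorm (N : ℕ) (y : ℝ) (Qt Qinf : ℕ → ℝ[X])
    (hQt : IsSkewOrthogonalFamily (skew4Mod (Set.Iic (Real.sqrt 2 * y))) Qt)
    (hQinf : IsSkewOrthogonalFamily (skew4 Set.univ) Qinf) :
    largestCDF 4 N y = ∏ j ∈ Finset.range N, (2 : ℝ) ^ (-2 * (j : ℝ) - 1 / 2) *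
      (skewNorm (skew4Mod (Set.Iic (Real.sqrt 2 * y))) Qt j /
        skewNorm (skew4 Set.univ) Qinf j) := by
  rw [largestCDF_eq (integrable_eigWeight_four N), eigIntegral_four_rescaled N _ Qt hQt.1,
    eigIntegral_four N _ Qinf hQinf.1, sqrt_two_smul_Iic, pfaffian_skewOrthogonal hQt,
    pfaffian_skewOrthogonal hQinf, mul_div_mul_left _ _ (by positivity), prod_rescale,
    Finset.prod_mul_distrib, Finset.prod_div_distrib, mul_div_assoc]

theorem prod_hermite_odd (N : ℕ) :
    ∏ j ∈ Finset.range N, (Real.sqrt Real.pi * (2 * j + 1).factorial / 2 ^ (2 * j + 1)) =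
      Real.pi ^ ((N : ℝ) / 2) / 2 ^ (N ^ 2) *
        ∏ j ∈ Finset.range N, ((2 * j + 1).factorial : ℝ) := by
  have hpi : Real.pi ^ ((N : ℝ) / 2) = Real.sqrt Real.pi ^ N := by
    rw [Real.sqrt_eq_rpow, ← Real.rpow_natCast, ← Real.rpow_mul Real.pi_pos.le]
    congr 1
    ring
  rw [hpi]
  clear hpi
  induction N with
  | zero => simp
  | succ N ih =>
    have h : (N + 1) ^ 2 = N ^ 2 + (2 * N + 1) := by ring
    rw [Finset.prod_range_succ, Finset.prod_range_succ, ih, h, pow_add, pow_succ (Real.sqrt _)]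
    field_simp
    ring

theorem largestCDF_four_pfaffian (N : ℕ) (y : ℝ) (p : ℕ → ℝ[X])
    (hp : IsNadalMajumdar (Real.sqrt 2 * y) p) :
    largestCDF 4 N y = (2 : ℝ) ^ (N ^ 2) / Real.pi ^ ((N : ℝ) / 2) *
      (∏ j ∈ Finset.range N, 1 / ((2 * j + 1).factorial : ℝ)) *
        pfaffian (wMatrix (Real.sqrt 2 * y) p (2 * N)) := by
  obtain ⟨H, hH⟩ := exists_isOrthogonalFamily_ip2 (Set.subset_univ (Set.Iio 0))
  have hs : Real.sqrt 2 ≠ 0 := by positivity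
  have hk : ∏ j ∈ Finset.range (2 * N), (Real.sqrt 2)⁻¹ ^ j ≠ 0 :=
    Finset.prod_ne_zero_iff.mpr fun j _ => pow_ne_zero _ (inv_ne_zero hs)
  -- Numerator and denominator are both rescaled, so the powers of √2 cancel.
  rw [largestCDF_eq (integrable_eigWeight_four N), eigIntegral_four_rescaled N _ p hp.1,
    eigIntegral_four_rescaled N _ H hH.1, sqrt_two_smul_Iic, Set.smul_set_univ₀ hs,
    mul_div_mul_left _ _ (by positivity), mul_div_mul_left _ _ hk,
    pfaffian_skew4Mod_hermite hH, wMatrix_eq hp]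
  simp_rw [ip2_hermite hH]
  rw [prod_hermite_odd, Finset.prod_div_distrib, Finset.prod_const_one]
  have h1 : Real.pi ^ ((N : ℝ) / 2) ≠ 0 := (Real.rpow_pos_of_pos Real.pi_pos _).ne'
  have h2 : ∏ j ∈ Finset.range N, ((2 * j + 1).factorial : ℝ) ≠ 0 :=
    Finset.prod_ne_zero_iff.mpr fun j _ => by positivity
  field_simp

/-! ### Gram matrices for `β = 1` -/

theorem exp_neg_sq_div_two (x : ℝ) : Real.exp (-x ^ 2 / 2) = Real.exp (-(1 / 2) * x ^ 2) := by
  congr 1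
  ring

theorem continuous_erf : Continuous erf := by
  unfold erf
  refine continuous_const.mul (intervalIntegral.continuous_primitive (fun a b => ?_) 0)
  exact Continuous.intervalIntegrable (by fun_prop) _ _

theorem abs_erf_le (x : ℝ) : ‖erf x‖ ≤ 2 := by
  have hpi : 0 < Real.sqrt Real.pi := Real.sqrt_pos.mpr Real.pi_pos
  have hint : Integrable fun t : ℝ => Real.exp (-t ^ 2) := by
    simpa using integrable_exp_neg_sq_poly 1
  have h : ‖∫ t in (0 : ℝ)..x, Real.exp (-t ^ 2)‖ ≤ Real.sqrt Real.pi := by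
    refine (intervalIntegral.norm_integral_le_integral_norm_uIoc).trans ?_
    refine (setIntegral_le_integral hint.norm
      (Filter.Eventually.of_forall fun t => norm_nonneg _)).trans (le_of_eq ?_)
    simpa using integral_gaussian 1
  rw [erf, norm_mul, Real.norm_of_nonneg (by positivity), div_mul_eq_mul_div, div_le_iff₀ hpi]
  linarith

theorem integral_Iic_exp (x : ℝ) : ∫ z in Set.Iic x, Real.exp (-z ^ 2 / 2) =
    Real.sqrt (2 * Real.pi) / 2 * (1 + erf (x / Real.sqrt 2)) := by
  have hint : Integrable fun t : ℝ => Real.exp (-t ^ 2 / 2) := by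
    simpa using integrable_exp_neg_sq_half_poly 1
  have h1 := intervalIntegral.integral_Iic_sub_Iic (μ := volume) (a := 0) (b := x)
    hint.integrableOn hint.integrableOn
  have h2 := intervalIntegral.integral_Iic_add_Ioi (μ := volume) (b := (0 : ℝ))
    hint.integrableOn hint.integrableOn
  have h3 : ∫ t : ℝ, Real.exp (-t ^ 2 / 2) = Real.sqrt (2 * Real.pi) := by
    simp_rw [exp_neg_sq_div_two]
    rw [integral_gaussian]
    congr 1
    ring
  have h4 : ∫ t in Set.Ioi (0 : ℝ), Real.exp (-t ^ 2 / 2) = Real.sqrt (2 * Real.pi) / 2 := by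
    simp_rw [exp_neg_sq_div_two]
    rw [integral_gaussian_Ioi]
    congr 2
    ring
  have h5 : ∫ t in (0 : ℝ)..x, Real.exp (-t ^ 2 / 2) =
      Real.sqrt 2 * ∫ t in (0 : ℝ)..x / Real.sqrt 2, Real.exp (-t ^ 2) := by
    have := intervalIntegral.integral_comp_div (a := 0) (b := x) (fun t => Real.exp (-t ^ 2))
      (c := Real.sqrt 2) (by positivity)
    rw [zero_div, smul_eq_mul] at this
    rw [← this]
    congr 1
    funext t
    rw [div_pow, Real.sq_sqrt (by norm_num), neg_div]
  have hpi : Real.sqrt Real.pi ≠ 0 := (Real.sqrt_pos.mpr Real.pi_pos).ne'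
  have h6 : Real.sqrt (2 * Real.pi) / 2 * erf (x / Real.sqrt 2) =
      Real.sqrt 2 * ∫ t in (0 : ℝ)..x / Real.sqrt 2, Real.exp (-t ^ 2) := by
    rw [erf, Real.sqrt_mul (by norm_num)]
    field_simp
  rw [mul_add, h6, ← h5]
  linarith

/-- Since e^{-x²/2}(q' - x q) = (e^{-x²/2} q)', only the constant c produces an error function when
g is integrated against the Gaussian. The top coefficient of q later supplies the norm h_j. -/
theorem exists_gauss_primitive (n : ℕ) (g : ℝ[X]) (hg : g ∈ degreeLT ℝ (n + 1)) :
    ∃ (c : ℝ) (q : ℝ[X]), q ∈ degreeLT ℝ n ∧ (∀ m, n = m + 1 → q.coeff m = -g.coeff n) ∧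
      g = C c + (q.derivative - X * q) := by
  induction n generalizing g with
  | zero =>
    refine ⟨g.coeff 0, 0, Submodule.zero_mem _, fun m hm => by omega, ?_⟩
    have : g.natDegree < 0 + 1 := by
      rcases eq_or_ne g 0 with rfl | h
      · simp
      · exact (natDegree_lt_iff_degree_lt h).mpr (Polynomial.mem_degreeLT.mp hg)
    simpa using eq_C_of_natDegree_eq_zero (by omega)
  | succ n ih =>
    set a := g.coeff (n + 1)
    have h1 : g - C a * X ^ (n + 1) ∈ degreeLT ℝ (n + 1) :=
      isMonicFamily_X_pow.sub_mem_degreeLT hg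
    -- Taking q = -x^n gives x^{n+1} = n x^{n-1} + (q' - x q). For n = 0 the coefficient vanishes,
    -- so the truncated exponent is harmless.
    have h2 : C (a * n) * X ^ (n - 1) ∈ degreeLT ℝ (n + 1) := by
      rw [← smul_eq_C_mul]
      exact Submodule.smul_mem _ _ (isMonicFamily_X_pow.mem_degreeLT (by omega))
    obtain ⟨c, q, hq, -, hgq⟩ := ih _ (Submodule.add_mem _ h1 h2)
    refine ⟨c, q - C a * X ^ n, ?_, ?_, ?_⟩
    · refine Submodule.sub_mem _ (degreeLT_le n.le_succ hq) ?_
      rw [← smul_eq_C_mul]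
      exact Submodule.smul_mem _ _ (isMonicFamily_X_pow.mem_degreeLT n.lt_succ_self)
    · intro m hm
      obtain rfl : n = m := by omega
      have : q.coeff n = 0 := by
        rw [Polynomial.mem_degreeLT, degree_lt_iff_coeff_zero] at hq
        exact hq n le_rfl
      simp [this, a]
    · have : g = (g - C a * X ^ (n + 1) + C (a * n) * X ^ (n - 1)) +
          (C a * X ^ (n + 1) - C (a * n) * X ^ (n - 1)) := by ring
      rw [this, hgq]
      simp only [derivative_sub, derivative_C_mul_X_pow, pow_succ]
      ring

/-- The inner integral of `skew1`. -/
theorem integral_mul_sign {D : Set ℝ} {x : ℝ} (hx : Set.Iic x ⊆ D) (g : ℝ[X]) :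
    ∫ z in D, Real.exp (-z ^ 2 / 2) * g.eval z * Real.sign (z - x) =
      (∫ z in D, Real.exp (-z ^ 2 / 2) * g.eval z) -
        2 * ∫ z in Set.Iic x, Real.exp (-z ^ 2 / 2) * g.eval z := by
  have hi := integrable_exp_neg_sq_half_poly g
  have h1 : ∫ z in D, Real.exp (-z ^ 2 / 2) * g.eval z * Real.sign (z - x) =
      ∫ z in D, (Real.exp (-z ^ 2 / 2) * g.eval z -
        2 * (Set.Iic x).indicator (fun z => Real.exp (-z ^ 2 / 2) * g.eval z) z) := by
    refine integral_congr_ae (ae_restrict_of_ae ?_)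
    have hne : ∀ᵐ z : ℝ, z ≠ x := by simp [ae_iff]
    filter_upwards [hne] with z hz
    rcases lt_or_gt_of_ne hz with h | h
    · rw [Real.sign_of_neg (sub_neg.mpr h), Set.indicator_of_mem (Set.mem_Iic.mpr h.le)]
      ring
    · rw [Real.sign_of_pos (sub_pos.mpr h), Set.indicator_of_notMem (by simpa using h)]
      ring
  rw [h1, integral_sub hi.integrableOn ((hi.indicator measurableSet_Iic).const_mul 2).integrableOn,
    integral_const_mul, setIntegral_indicator measurableSet_Iic, Set.inter_eq_right.mpr hx]

theorem integral_Iic_of_primitive {g q : ℝ[X]} {c : ℝ} (hg : g = C c + (q.derivative - X * q))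
    (x : ℝ) : ∫ z in Set.Iic x, Real.exp (-z ^ 2 / 2) * g.eval z =
      c * (Real.sqrt (2 * Real.pi) / 2 * (1 + erf (x / Real.sqrt 2))) +
        Real.exp (-x ^ 2 / 2) * q.eval x := by
  have h1 := (integrable_exp_neg_sq_half_poly (C c)).integrableOn (s := Set.Iic x)
  have h2 := (integrable_exp_neg_sq_half_poly (q.derivative - X * q)).integrableOn (s := Set.Iic x)
  have h3 := integral_Iic_gauss_deriv (b := 1 / 2) (by norm_num) x q
  have h4 : (C (2 * (1 / 2)) : ℝ[X]) = 1 := by norm_num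
  rw [h4, one_mul] at h3
  simp_rw [← exp_neg_sq_div_two] at h3
  have h5 : ∫ z in Set.Iic x, Real.exp (-z ^ 2 / 2) * (C c).eval z =
      c * ∫ z in Set.Iic x, Real.exp (-z ^ 2 / 2) := by
    rw [← integral_const_mul]
    congr 1
    funext z
    rw [eval_C, mul_comm]
  rw [← integral_Iic_exp, ← h3, ← h5, ← integral_add h1 h2]
  congr 1
  funext z
  rw [hg, eval_add]
  ring

theorem integral_of_primitive {g q : ℝ[X]} {c : ℝ} (hg : g = C c + (q.derivative - X * q)) :
    ∫ z, Real.exp (-z ^ 2 / 2) * g.eval z = c * Real.sqrt (2 * Real.pi) := by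
  have h1 := integrable_exp_neg_sq_half_poly (C c)
  have h2 := integrable_exp_neg_sq_half_poly (q.derivative - X * q)
  have h3 := integral_gauss_deriv (b := 1 / 2) (by norm_num) q
  have h4 : (C (2 * (1 / 2)) : ℝ[X]) = 1 := by norm_num
  rw [h4, one_mul] at h3
  simp_rw [← exp_neg_sq_div_two] at h3
  have h5 : ∫ z : ℝ, Real.exp (-z ^ 2 / 2) * (C c).eval z = c * Real.sqrt (2 * Real.pi) := by
    have h6 := integral_gaussian (1 / 2)
    simp_rw [← exp_neg_sq_div_two] at h6
    rw [show 2 * Real.pi = Real.pi / (1 / 2) by ring, ← h6, ← integral_const_mul]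
    congr 1
    funext z
    rw [eval_C, mul_comm]
  rw [← h5, ← add_zero (∫ z : ℝ, Real.exp (-z ^ 2 / 2) * (C c).eval z), ← h3,
    ← integral_add h1 h2]
  congr 1
  funext z
  rw [hg, eval_add]
  ring

theorem integrable_mul_erf (f : ℝ[X]) :
    Integrable fun x => f.eval x * Real.exp (-x ^ 2 / 2) * erf (x / Real.sqrt 2) := by
  have h := (integrable_exp_neg_sq_half_poly f).mul_bdd (c := 2)
    (g := fun x => erf (x / Real.sqrt 2))
    (continuous_erf.comp (continuous_id.div_const _)).aestronglyMeasurable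
    (Filter.Eventually.of_forall fun x => abs_erf_le _)
  refine h.congr (Filter.Eventually.of_forall fun x => ?_)
  simp only
  ring

/-- The inner integral is evaluated through the primitive of g. For D = (-∞, y] the first two terms
become -Φ and -X, and the last one is accessible to orthogonality. -/
theorem skew1_eq_of_primitive {D : Set ℝ} (hDm : MeasurableSet D)
    (hD : ∀ x ∈ D, Set.Iic x ⊆ D) (f : ℝ[X]) {g q : ℝ[X]} {c : ℝ}
    (hg : g = C c + (q.derivative - X * q)) :
    skew1 D f g = (1 / 2) * (∫ x in D, Real.exp (-x ^ 2 / 2) * f.eval x) *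
        ((∫ z in D, Real.exp (-z ^ 2 / 2) * g.eval z) - ∫ z, Real.exp (-z ^ 2 / 2) * g.eval z) -
      (1 / 2) * (∫ x in D, f.eval x * Real.exp (-x ^ 2 / 2) * erf (x / Real.sqrt 2)) *
        (∫ z, Real.exp (-z ^ 2 / 2) * g.eval z) - ip2 D f q := by
  set A := ∫ z in D, Real.exp (-z ^ 2 / 2) * g.eval z
  have hI := integral_of_primitive hg
  set I := ∫ z, Real.exp (-z ^ 2 / 2) * g.eval z
  have i1 := (integrable_exp_neg_sq_half_poly f).integrableOn (s := D)
  have i2 := (integrable_mul_erf f).integrableOn (s := D)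
  have i3 : IntegrableOn (fun x => Real.exp (-x ^ 2) * f.eval x * q.eval x) D := by
    simpa only [neg_mul, one_mul] using (integrable_mul_gauss one_pos f q).integrableOn
  have h1 : ∫ x in D, Real.exp (-x ^ 2 / 2) * f.eval x *
      ∫ z in D, Real.exp (-z ^ 2 / 2) * g.eval z * Real.sign (z - x) =
      ∫ x in D, ((A - I) * (Real.exp (-x ^ 2 / 2) * f.eval x) -
        I * (f.eval x * Real.exp (-x ^ 2 / 2) * erf (x / Real.sqrt 2)) -
        2 * (Real.exp (-x ^ 2) * f.eval x * q.eval x)) := by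
    refine setIntegral_congr_fun hDm fun x hx => ?_
    rw [integral_mul_sign (hD x hx), integral_Iic_of_primitive hg, hI]
    have : Real.exp (-x ^ 2) = Real.exp (-x ^ 2 / 2) * Real.exp (-x ^ 2 / 2) := by
      rw [← Real.exp_add]
      congr 1
      ring
    rw [this]
    ring
  have i4 : IntegrableOn (fun x => (A - I) * (Real.exp (-x ^ 2 / 2) * f.eval x) -
        I * (f.eval x * Real.exp (-x ^ 2 / 2) * erf (x / Real.sqrt 2))) D :=
    (i1.const_mul (A - I)).sub (i2.const_mul I)
  rw [skew1, h1, integral_sub i4 (i3.const_mul 2),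
    integral_sub (i1.const_mul (A - I)) (i2.const_mul I), integral_const_mul, integral_const_mul,
    integral_const_mul, ip2]
  ring

/-- The primitive polynomial q of p_k has degree below k ≤ j + 1, so (p_j, q)_2 sees only its
coefficient of x^j, which is -1 if k = j + 1 and 0 otherwise. Entries with k ≥ j + 2 are reached by
skew symmetry, whence the reversed indices in `vEntry`. -/
theorem skew1_nadalMajumdar {y : ℝ} {p : ℕ → ℝ[X]} (hp : IsNadalMajumdar y p) {j k : ℕ}
    (hkj : k ≤ j + 1) : skew1 (Set.Iic y) (p j) (p k) =
      (if j + 1 = k then hNorm y p j else 0) - xEntry y p j k - phiEntry y p j k := by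
  obtain ⟨c, q, hq, hc, hg⟩ := exists_gauss_primitive k (p k) (hp.1.mem_degreeLT k.lt_succ_self)
  rw [skew1_eq_of_primitive measurableSet_Iic
    (fun x (hx : x ≤ y) => Set.Iic_subset_Iic.mpr hx) (p j) hg]
  have hi := integrable_exp_neg_sq_half_poly (p k)
  have h1 := intervalIntegral.integral_Iic_add_Ioi (μ := volume) (b := y)
    hi.integrableOn hi.integrableOn
  have h2 : ip2 (Set.Iic y) (p j) q = -if j + 1 = k then hNorm y p j else 0 := by
    split_ifs with h
    · rw [ip2_eq_coeff_mul hp (h ▸ hq), hc j h.symm, hp.1.coeff_self, hNorm]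
      ring
    · rw [ip2_eq_zero_of_mem hp (degreeLT_le (by omega) hq), neg_zero]
  rw [h2, ← h1, xEntry, phiEntry, ← h1]
  ring

theorem vMatrix_eq {y : ℝ} {p : ℕ → ℝ[X]} (hp : IsNadalMajumdar y p) (m : ℕ) :
    vMatrix y p m = Matrix.of fun j k : Fin m => skew1 (Set.Iic y) (p j) (p k) := by
  refine skewMatrix_eq_of (skew1_swap _) (fun j k hjk => ?_) m
  rw [vEntry]
  split_ifs with h
  · rw [skew1_nadalMajumdar hp (by omega), if_pos h]
  · rw [skew1_swap, skew1_nadalMajumdar hp (by omega), if_neg (by omega)]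
    ring

/-! ### The Gram matrix on the full line for β = 1. -/

section Hermite

variable {H : ℕ → ℝ[X]}

/-- The family (-1)^j H_j(-x) is again monic and orthogonal, so uniqueness identifies it with H. -/
theorem hermite_comp_neg (hH : IsOrthogonalFamily (ip2 Set.univ) H) (j : ℕ) (x : ℝ) :
    (H j).eval (-x) = (-1) ^ j * (H j).eval x := by
  have hmon : IsMonicFamily fun j => C ((-1) ^ j) * (H j).comp (-X) := by
    intro j
    have hn : ((H j).comp (-X)).natDegree = j := by
      rw [natDegree_comp, natDegree_neg, natDegree_X, mul_one, (hH.1 j).2]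
    beta_reduce
    constructor
    · rw [Monic, leadingCoeff_mul, leadingCoeff_C, leadingCoeff_comp (by simp),
        (hH.1 j).1.leadingCoeff, leadingCoeff_neg, leadingCoeff_X, (hH.1 j).2, one_mul, ← mul_pow]
      simp
    · rw [natDegree_C_mul (pow_ne_zero _ (by norm_num)), hn]
  have horth : IsOrthogonalFamily (ip2 Set.univ) fun j => C ((-1) ^ j) * (H j).comp (-X) := by
    refine ⟨hmon, fun j k hjk => ?_⟩
    have h := hH.2 j k hjk
    rw [ip2, setIntegral_univ, ← integral_neg_eq_self] at h
    rw [ip2, setIntegral_univ, ← mul_zero ((-1) ^ j * (-1) ^ k : ℝ), ← h, ← integral_const_mul]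
    congr 1
    funext x
    simp
    ring
  have h := congrFun (IsOrthogonalFamily.unique (B := ip2Form Set.univ)
    (ip2Form_self_eq_zero (Set.subset_univ (Set.Iio 0))) hH horth) j
  have h2 := congrArg (eval (-x)) h
  simpa using h2

theorem skew1_hermite_eq_zero (hH : IsOrthogonalFamily (ip2 Set.univ) H) {j k : ℕ}
    (hjk : Even (j + k)) : skew1 Set.univ (H j) (H k) = 0 := by
  have h : skew1 Set.univ (H j) (H k) = -skew1 Set.univ (H j) (H k) := by
    conv_lhs => rw [skew1, setIntegral_univ, ← integral_neg_eq_self]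
    rw [skew1, setIntegral_univ, ← mul_neg, ← integral_neg]
    congr 2
    funext x
    rw [setIntegral_univ, setIntegral_univ, ← integral_neg_eq_self, ← integral_const_mul,
      ← mul_neg, ← integral_neg, ← integral_const_mul]
    congr 1
    funext z
    have hs : Real.sign (-z - -x) = -Real.sign (z - x) := by rw [← Real.sign_neg]; congr 1; ring
    have hpow : ((-1 : ℝ) ^ j) * (-1) ^ k = 1 := by rw [← pow_add, hjk.neg_one_pow]
    rw [hs, hermite_comp_neg hH, hermite_comp_neg hH, neg_sq, neg_sq]
    linear_combination (-Real.exp (-x ^ 2 / 2) * eval x (H j) * (Real.exp (-z ^ 2 / 2) *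
      eval z (H k) * Real.sign (z - x))) * hpow
  linarith

/-- For odd k the Gaussian integral of H_k vanishes by parity and removes the error-function term,
leaving only -(H_j, q)_2. -/
theorem skew1_hermite_odd (hH : IsOrthogonalFamily (ip2 Set.univ) H) {j k : ℕ} (hk : Odd k)
    (hkj : k ≤ j + 1) : skew1 Set.univ (H j) (H k) =
      if j + 1 = k then ip2 Set.univ (H j) (H j) else 0 := by
  obtain ⟨c, q, hq, hc, hg⟩ := exists_gauss_primitive k (H k) (hH.1.mem_degreeLT k.lt_succ_self)
  have hI : ∫ z, Real.exp (-z ^ 2 / 2) * (H k).eval z = 0 := by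
    have h : ∫ z, Real.exp (-z ^ 2 / 2) * (H k).eval z =
        -∫ z, Real.exp (-z ^ 2 / 2) * (H k).eval z := by
      conv_lhs => rw [← integral_neg_eq_self]
      rw [← integral_neg]
      congr 1
      funext z
      rw [hermite_comp_neg hH, hk.neg_one_pow, neg_sq]
      ring
    linarith
  rw [skew1_eq_of_primitive MeasurableSet.univ (fun x _ => Set.subset_univ _) (H j) hg,
    setIntegral_univ (f := fun z => Real.exp (-z ^ 2 / 2) * (H k).eval z), hI]
  split_ifs with h
  · rw [ip2_eq_coeff_mul hH (h ▸ hq), hc j h.symm, hH.1.coeff_self]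
    ring
  · rw [ip2_eq_zero_of_mem hH (degreeLT_le (by omega) hq)]
    ring

/-- Equal parities give zero, and `skew1_hermite_odd` gives the even-odd block on and below its
diagonal. The block is upper triangular, so its other entries are not needed. -/
theorem pfaffian_skew1_hermite (hH : IsOrthogonalFamily (ip2 Set.univ) H) (n : ℕ) :
    pfaffian (Matrix.of fun j k : Fin (2 * n) => skew1 Set.univ (H j) (H k)) =
      ∏ j ∈ Finset.range n, ip2 Set.univ (H (2 * j)) (H (2 * j)) := by
  rw [pfaffian_eq_det _ (Matrix.of fun i j : Fin n =>
      skew1 Set.univ (H (2 * i)) (H (2 * j + 1))), Matrix.det_of_isUpperTriangular,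
    Finset.prod_range]
  · refine Finset.prod_congr rfl fun i _ => ?_
    rw [Matrix.of_apply, skew1_hermite_odd hH ⟨i, rfl⟩ le_rfl, if_pos rfl]
  · intro i j hij
    have : (j : ℕ) < i := hij
    rw [Matrix.of_apply, skew1_hermite_odd hH ⟨j, rfl⟩ (by omega), if_neg (by omega)]
  · intro i j
    simp only [Matrix.of_apply, pairEquiv_val]
    exact skew1_hermite_eq_zero hH ⟨i + j, by simp; ring⟩
  · intro i j
    simp only [Matrix.of_apply, pairEquiv_val]
    exact skew1_hermite_eq_zero hH ⟨i + j + 1, by simp; ring⟩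
  · intro i j
    simp [pairEquiv_val]
  · intro i j
    simp only [Matrix.of_apply, pairEquiv_val]
    rw [skew1_swap]
    simp

end Hermite

/-! ### The distribution function for β = 1. -/

theorem largestCDF_one_skewNorm (n : ℕ) (y : ℝ) (R Rinf : ℕ → ℝ[X])
    (hR : IsSkewOrthogonalFamily (skew1 (Set.Iic y)) R)
    (hRinf : IsSkewOrthogonalFamily (skew1 Set.univ) Rinf) :
    largestCDF 1 (2 * n) y = ∏ j ∈ Finset.range n,
      skewNorm (skew1 (Set.Iic y)) R j / skewNorm (skew1 Set.univ) Rinf j := by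
  rw [largestCDF_eq (integrable_eigWeight_one _), eigIntegral_one n _ R hR.1,
    eigIntegral_one n _ Rinf hRinf.1, pfaffian_skewOrthogonal hR,
    pfaffian_skewOrthogonal hRinf, mul_div_mul_left _ _ (by positivity), Finset.prod_div_distrib]

theorem prod_hermite_even (n : ℕ) :
    ∏ j ∈ Finset.range n, (Real.sqrt Real.pi * (2 * j).factorial / 2 ^ (2 * j)) =
      Real.pi ^ ((n : ℝ) / 2) / 2 ^ (n * (n - 1)) *
        ∏ j ∈ Finset.range n, ((2 * j).factorial : ℝ) := by
  have hpi : Real.pi ^ ((n : ℝ) / 2) = Real.sqrt Real.pi ^ n := by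
    rw [Real.sqrt_eq_rpow, ← Real.rpow_natCast, ← Real.rpow_mul Real.pi_pos.le]
    congr 1
    ring
  rw [hpi]
  clear hpi
  induction n with
  | zero => simp
  | succ n ih =>
    have h : (n + 1) * (n + 1 - 1) = n * (n - 1) + 2 * n := by
      cases n with
      | zero => rfl
      | succ m => simp only [Nat.add_sub_cancel]; ring
    rw [Finset.prod_range_succ, Finset.prod_range_succ, ih, h, pow_add, pow_succ (Real.sqrt _)]
    field_simp
    ring

theorem largestCDF_one_pfaffian (n : ℕ) (y : ℝ) (p : ℕ → ℝ[X]) (hp : IsNadalMajumdar y p) :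
    largestCDF 1 (2 * n) y = (2 : ℝ) ^ (n * (n - 1)) / Real.pi ^ ((n : ℝ) / 2) *
      (∏ j ∈ Finset.range n, 1 / ((2 * j).factorial : ℝ)) * pfaffian (vMatrix y p (2 * n)) := by
  obtain ⟨H, hH⟩ := exists_isOrthogonalFamily_ip2 (Set.subset_univ (Set.Iio 0))
  rw [largestCDF_eq (integrable_eigWeight_one _), eigIntegral_one n _ p hp.1,
    eigIntegral_one n _ H hH.1, mul_div_mul_left _ _ (by positivity),
    pfaffian_skew1_hermite hH, vMatrix_eq hp]
  simp_rw [ip2_hermite hH]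
  rw [prod_hermite_even, Finset.prod_div_distrib, Finset.prod_const_one]
  have h1 : Real.pi ^ ((n : ℝ) / 2) ≠ 0 := (Real.rpow_pos_of_pos Real.pi_pos _).ne'
  have h2 : ∏ j ∈ Finset.range n, ((2 * j).factorial : ℝ) ≠ 0 :=
    Finset.prod_ne_zero_iff.mpr fun j _ => by positivity
  field_simp

end GaussianBeta

end

open GaussianBeta in
theorem mainTheorem1 :
    -- the (skew-)orthogonal families exist, for every finite parameter and for parameter `∞`
    (∀ y : ℝ, ∃! p : ℕ → ℝ[X], IsNadalMajumdar y p) ∧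
    (∀ y : ℝ, ∃ R : ℕ → ℝ[X], IsSkewOrthogonalFamily (skew1 (Set.Iic y)) R) ∧
    (∃ R : ℕ → ℝ[X], IsSkewOrthogonalFamily (skew1 Set.univ) R) ∧
    (∀ y : ℝ, ∃ Q : ℕ → ℝ[X], IsSkewOrthogonalFamily (skew4Mod (Set.Iic y)) Q) ∧
    (∃ Q : ℕ → ℝ[X], IsSkewOrthogonalFamily (skew4 Set.univ) Q) ∧
    -- GOE with an even number `N = 2 * n` of eigenvalues
    (∀ (n : ℕ) (y : ℝ) (p R Rinf : ℕ → ℝ[X]),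
      IsNadalMajumdar y p →
      IsSkewOrthogonalFamily (skew1 (Set.Iic y)) R →
      IsSkewOrthogonalFamily (skew1 Set.univ) Rinf →
      largestCDF 1 (2 * n) y =
        ∏ j ∈ Finset.range n,
          skewNorm (skew1 (Set.Iic y)) R j / skewNorm (skew1 Set.univ) Rinf j ∧
      largestCDF 1 (2 * n) y =
        (2 : ℝ) ^ (n * (n - 1)) / Real.pi ^ ((n : ℝ) / 2) *
          (∏ j ∈ Finset.range n, 1 / ((2 * j).factorial : ℝ)) *
          pfaffian (vMatrix y p (2 * n))) ∧
    -- GSE with `N` eigenvalues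
    (∀ (N : ℕ) (y : ℝ) (p Qt Qinf : ℕ → ℝ[X]),
      IsNadalMajumdar (Real.sqrt 2 * y) p →
      IsSkewOrthogonalFamily (skew4Mod (Set.Iic (Real.sqrt 2 * y))) Qt →
      IsSkewOrthogonalFamily (skew4 Set.univ) Qinf →
      largestCDF 4 N y =
        ∏ j ∈ Finset.range N,
          (2 : ℝ) ^ (-2 * (j : ℝ) - 1 / 2) *
            (skewNorm (skew4Mod (Set.Iic (Real.sqrt 2 * y))) Qt j /
              skewNorm (skew4 Set.univ) Qinf j) ∧
      largestCDF 4 N y =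
        (2 : ℝ) ^ (N ^ 2) / Real.pi ^ ((N : ℝ) / 2) *
          (∏ j ∈ Finset.range N, 1 / ((2 * j + 1).factorial : ℝ)) *
          pfaffian (wMatrix (Real.sqrt 2 * y) p (2 * N))) := by
  refine ⟨fun y => ?_, fun y => exists_isSkewOrthogonalFamily_skew1 Set.Iio_subset_Iic_self,
    exists_isSkewOrthogonalFamily_skew1 (Set.subset_univ (Set.Iio 0)),
    exists_isSkewOrthogonalFamily_skew4Mod,
    exists_isSkewOrthogonalFamily_skew4 (Set.subset_univ (Set.Iio 0)),
    fun n y p R Rinf hp hR hRinf => ⟨largestCDF_one_skewNorm n y R Rinf hR hRinf,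
      largestCDF_one_pfaffian n y p hp⟩,
    fun N y p Qt Qinf hp hQt hQinf => ⟨largestCDF_four_skewNorm N y Qt Qinf hQt hQinf,
      largestCDF_four_pfaffian N y p hp⟩⟩
  obtain ⟨p, hp⟩ := exists_isOrthogonalFamily_ip2 (Set.Iio_subset_Iic_self (a := y))
  exact ⟨p, hp, fun p' hp' => IsOrthogonalFamily.unique (B := ip2Form (Set.Iic y))
    (ip2Form_self_eq_zero Set.Iio_subset_Iic_self) hp' hp⟩
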